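/- All graphs are finite, simple and undirected, with at least one vertex. An admissible sequence is a sequence of pairs $(G_n,d_n)$, where $d_n\ge 1$ is a real number and $G_n$ is a graph with all degrees $\le d_n$. For a tree $F$ put $$t(F,G_n,d_n)=\frac{\hom(F,G_n)}{|V(G_n)|\,d_n^{|V(F)|-1}},$$ where $\hom(F,G_n)$ is the number of graph homomorphisms $F\to G_n$. For a compact metric space $K$ let $\mathcal M(K)$ be the compact metrizable space of Borel measures on $K$ of total mass $\le 1$, with the topology of weak convergence; a continuous map $f:K\to L$ induces the push-forward $f_*:\mathcal M(K)\to\mathcal M(L)$. Let $M_0$ be a point and $M_{r+1}=\mathcal M(M_r)$ for $r\ge 0$. Let $f_0:M_1\to M_0$ be the unique map and $f_{r+1}=(f_r)_*:M_{r+2}\to M_{r+1}$. Let $M$ be the compact space of consistent sequences $\sigma=(\sigma_r)_{r\ge0}\in\prod_{r\ge 0} M_r$, i.e. those with $f_r(\sigma_{r+1})=\sigma_r$ for all $r$, with the topology induced from the product and with its Borel $\sigma$-algebra $\mathcal B$. The canonical sub-Markov kernel $\deg$ on $M$ is the unique one with $$\deg(\sigma)(\{\tau\in M:\tau_r\in A\})=\sigma_{r+1}(A)$$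 for all $\sigma\in M$, $r\ge 0$ and Borel sets $A\subseteq M_r$. A Borel probability measure $\lambda$ on $M$ is involution-invariant if $\int_A\deg(x)(B)\,\mathrm d\lambda(x)=\int_B\deg(x)(A)\,\mathrm d\lambda(x)$ for all $A,B\in\mathcal B$. For such $\lambda$ and a tree $F$ whose vertices are labeled $0,1,\dots,m$ so that each vertex $i\ge1$ is adjacent to some vertex $j(i)<i$, put $$t(F,(M,\mathcal B,\lambda,\deg))=\int_M\int_M\cdots\int_M 1\;\mathrm d\deg(x_{j(m)})(x_m)\cdots\mathrm d\deg(x_{j(1)})(x_1)\,\mathrm d\lambda(x_0),$$ which does not depend on the labeling. **Theorem.** Let $(G_n,d_n)$ be an admissible sequence such that $t(F,G_n,d_n)$ converges as $n\to\infty$ for every tree $F$. Then there is a unique involution-invariant Borel probability measure $\lambda$ on $M$ such that $$t(F,G_n,d_n)\to t(F,(M,\mathcal B,\lambda,\deg))\qquad (n\to\infty)$$ for every tree $F$. -/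

import Mathlib

open MeasureTheory ProbabilityTheory Filter Topology
open scoped ENNReal NNReal

set_option linter.unusedSectionVars false

namespace GraphLimit

/-- Borel measures of total mass at most `1` on `K`. -/
def SubProb (K : Type) [MeasurableSpace K] : Type :=
  {μ : FiniteMeasure K // μ.mass ≤ 1}

namespace SubProb

section
variable {K L : Type} [TopologicalSpace K] [MeasurableSpace K] [BorelSpace K]
  [TopologicalSpace L] [MeasurableSpace L] [BorelSpace L]

/-- The topology of weak convergence of measures. -/
instance : TopologicalSpace (SubProb K) :=
  inferInstanceAs (TopologicalSpace {μ : FiniteMeasure K // μ.mass ≤ 1})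

instance : MeasurableSpace (SubProb K) := borel _

instance : BorelSpace (SubProb K) := ⟨rfl⟩

/-- The underlying measure. -/
noncomputable def toMeasure (μ : SubProb K) : Measure K := (μ.1 : Measure K)

instance (μ : SubProb K) : IsFiniteMeasure μ.toMeasure :=
  inferInstanceAs (IsFiniteMeasure (μ.1 : Measure K))

/-- The push-forward map `f_*` induced by a continuous map `f`. -/
noncomputable def map (f : C(K, L)) : C(SubProb K, SubProb L) where
  toFun μ := ⟨μ.1.map f, (FiniteMeasure.mass_map_le f μ.1).trans μ.2⟩
  continuous_toFun := Continuous.subtype_mk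
    ((FiniteMeasure.continuous_map f.continuous).comp continuous_subtype_val) _

theorem toMeasure_map (f : C(K, L)) (μ : SubProb K) :
    (map f μ).toMeasure = μ.toMeasure.map f := rfl

theorem ext {μ ν : SubProb K} (h : μ.toMeasure = ν.toMeasure) : μ = ν :=
  Subtype.ext (Subtype.ext h)

theorem map_id (μ : SubProb K) : map (ContinuousMap.id K) μ = μ :=
  ext (by rw [toMeasure_map]; exact Measure.map_id)

theorem map_map {N : Type} [TopologicalSpace N] [MeasurableSpace N] [BorelSpace N]
    (g : C(L, N)) (f : C(K, L)) (μ : SubProb K) : map g (map f μ) = map (g.comp f) μ :=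
  ext (by
    simp only [toMeasure_map]
    exact Measure.map_map g.continuous.measurable f.continuous.measurable)

theorem toMeasure_univ_le (μ : SubProb K) : μ.toMeasure Set.univ ≤ 1 := by
  have h := μ.2
  rw [← ENNReal.coe_le_coe, FiniteMeasure.ennreal_mass] at h
  exact h

noncomputable instance : Zero (SubProb K) := ⟨⟨0, by simp⟩⟩

theorem toMeasure_zero : (0 : SubProb K).toMeasure = 0 := rfl

theorem map_zero (f : C(K, L)) : map f 0 = 0 :=
  ext (by rw [toMeasure_map, toMeasure_zero, toMeasure_zero, Measure.map_zero])

instance [T2Space K] [CompactSpace K] : CompactSpace (SubProb K) :=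
  isCompact_iff_compactSpace.1
    (isCompact_setOfPred_finiteMeasure_le_of_compactSpace K 1)

instance [HasOuterApproxClosed K] : T2Space (SubProb K) :=
  inferInstanceAs (T2Space {μ : FiniteMeasure K // μ.mass ≤ 1})

instance [CompactSpace K] [TopologicalSpace.MetrizableSpace K] :
    TopologicalSpace.MetrizableSpace (SubProb K) := by
  let _ := TopologicalSpace.metrizableSpaceMetric K
  let u : ℕ → C(K, ℝ) := TopologicalSpace.denseSeq C(K, ℝ)
  let Φ : SubProb K → (ℕ → ℝ) := fun μ n => ∫ x, u n x ∂(μ.1 : Measure K)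
  have hc : Continuous Φ := continuous_pi fun n =>
    (FiniteMeasure.continuous_integral_continuousMap (u n)).comp continuous_subtype_val
  have hcont : ∀ μ : SubProb K, Continuous fun f : C(K, ℝ) => ∫ x, f x ∂(μ.1 : Measure K) := by
    intro μ
    have h1 : (fun f : C(K, ℝ) => ∫ x, f x ∂(μ.1 : Measure K)) =
        fun f => ∫ x, ContinuousMap.toLp (E := ℝ) 1 (μ.1 : Measure K) ℝ f x
          ∂(μ.1 : Measure K) := by
      funext f
      exact (integral_congr_ae (ContinuousMap.coeFn_toLp (μ.1 : Measure K) f)).symm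
    rw [h1]
    exact continuous_integral.comp (ContinuousMap.toLp (E := ℝ) 1 (μ.1 : Measure K) ℝ).continuous
  have hi : Function.Injective Φ := by
    intro μ ν h
    have h2 : (fun f : C(K, ℝ) => ∫ x, f x ∂(μ.1 : Measure K)) =
        fun f => ∫ x, f x ∂(ν.1 : Measure K) :=
      (TopologicalSpace.denseRange_denseSeq C(K, ℝ)).equalizer (hcont μ) (hcont ν)
        (by funext n; exact congrFun h n)
    refine Subtype.ext (FiniteMeasure.ext_of_forall_integral_eq fun f => ?_)
    exact congrFun h2 f.toContinuousMap
  exact (hc.isClosedEmbedding hi).isEmbedding.metrizableSpace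

theorem measurable_apply [TopologicalSpace.MetrizableSpace K] :
    Measurable (toMeasure : SubProb K → Measure K) := by
  have hfin : ∀ μ : SubProb K, IsFiniteMeasure μ.toMeasure := fun μ => inferInstance
  have hF : ∀ F : Set K, IsClosed F → Measurable fun μ : SubProb K => μ.toMeasure F := by
    intro F hF
    refine measurable_of_tendsto_metrizable (f := fun n (μ : SubProb K) =>
      ∫⁻ x, (hF.apprSeq n x : ℝ≥0∞) ∂μ.toMeasure) (fun n => ?_) ?_
    · have h1 : Continuous fun μ : SubProb K =>
          ∫⁻ x, (hF.apprSeq n x : ℝ≥0∞) ∂(μ.1 : Measure K) :=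
        (FiniteMeasure.continuous_lintegral_boundedContinuousFunction
          (hF.apprSeq n)).comp continuous_subtype_val
      exact h1.measurable
    · exact tendsto_pi_nhds.2 fun μ =>
        HasOuterApproxClosed.tendsto_lintegral_apprSeq hF μ.toMeasure
  refine Measurable.measure_of_isPiSystem (S := {s | IsClosed s}) ?_ isPiSystem_isClosed
    (fun s hs => hF s hs) (hF _ isClosed_univ)
  rw [BorelSpace.measurable_eq (α := K), borel_eq_generateFrom_isClosed]

end

end SubProb

/-- A type with a topology and its Borel `σ`-algebra. -/
structure BorelType where
  carrier : Type
  [top : TopologicalSpace carrier]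
  [meas : MeasurableSpace carrier]
  [borel : BorelSpace carrier]

attribute [instance] BorelType.top BorelType.meas BorelType.borel

/-- The iterated measure spaces: `M₀` is a point and `M_{r+1}` is the space of Borel
sub-probability measures on `M_r`. -/
noncomputable def iterType : ℕ → BorelType
  | 0 => { carrier := PUnit, borel := ⟨borel_eq_top_of_discrete.symm⟩ }
  | r + 1 => { carrier := SubProb (iterType r).carrier }

/-- The space `M_r`. -/
abbrev IterSpace (r : ℕ) : Type := (iterType r).carrier

instance : Subsingleton (IterSpace 0) := inferInstanceAs (Subsingleton PUnit)

/-- The unique point of `M₀`. -/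
def IterSpace.point : IterSpace 0 := PUnit.unit

theorem IterSpace.compact_metrizable (r : ℕ) :
    CompactSpace (IterSpace r) ∧ TopologicalSpace.MetrizableSpace (IterSpace r) := by
  induction r with
  | zero => exact ⟨inferInstanceAs (CompactSpace PUnit), inferInstanceAs
      (TopologicalSpace.MetrizableSpace PUnit)⟩
  | succ r ih =>
    have := ih.1
    have := ih.2
    exact ⟨inferInstanceAs (CompactSpace (SubProb (IterSpace r))),
      inferInstanceAs (TopologicalSpace.MetrizableSpace (SubProb (IterSpace r)))⟩

instance (r : ℕ) : CompactSpace (IterSpace r) := (IterSpace.compact_metrizable r).1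

instance (r : ℕ) : TopologicalSpace.MetrizableSpace (IterSpace r) :=
  (IterSpace.compact_metrizable r).2

/-- The connecting maps `f_r : M_{r+1} → M_r`: `f₀` is the unique map to the point, and
`f_{r+1} = (f_r)_*`. -/
noncomputable def connect : (r : ℕ) → C(IterSpace (r + 1), IterSpace r)
  | 0 => ContinuousMap.const _ IterSpace.point
  | r + 1 => SubProb.map (connect r)

/-- The space `M` of consistent sequences `(σ_r)`, `f_r (σ_{r+1}) = σ_r`, with the topology
induced from the product. -/
def ConsistentSpace : Type :=
  {σ : (r : ℕ) → IterSpace r // ∀ r, connect r (σ (r + 1)) = σ r}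

namespace ConsistentSpace

instance : TopologicalSpace ConsistentSpace :=
  inferInstanceAs (TopologicalSpace
    {σ : (r : ℕ) → IterSpace r // ∀ r, connect r (σ (r + 1)) = σ r})

instance : MeasurableSpace ConsistentSpace := borel _

instance : BorelSpace ConsistentSpace := ⟨rfl⟩

instance : CompactSpace ConsistentSpace := by
  refine isCompact_iff_compactSpace.1 (IsClosed.isCompact ?_)
  have h : {σ : (r : ℕ) → IterSpace r | ∀ r, connect r (σ (r + 1)) = σ r} =
      ⋂ r, {σ | connect r (σ (r + 1)) = σ r} := by
    ext σ
    simp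
  change IsClosed {σ : (r : ℕ) → IterSpace r | ∀ r, connect r (σ (r + 1)) = σ r}
  rw [h]
  refine isClosed_iInter fun r => isClosed_eq ?_ (continuous_apply r)
  exact (connect r).continuous.comp (continuous_apply (r + 1))

instance : TopologicalSpace.MetrizableSpace ConsistentSpace :=
  (Topology.IsEmbedding.subtypeVal
    (p := fun σ : (r : ℕ) → IterSpace r => ∀ r, connect r (σ (r + 1)) = σ r)).metrizableSpace

/-- The coordinate `σ ↦ σ_r`. -/
def proj (r : ℕ) : C(ConsistentSpace, IterSpace r) :=
  ⟨fun σ => σ.1 r, (continuous_apply r).comp continuous_subtype_val⟩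

/-- The coordinate `σ_{r+1}`, as a measure on `M_r`. -/
noncomputable def marginal (σ : ConsistentSpace) (r : ℕ) : SubProb (IterSpace r) :=
  proj (r + 1) σ

theorem connect_proj (r : ℕ) (σ : ConsistentSpace) :
    connect r (proj (r + 1) σ) = proj r σ := σ.2 r

theorem map_connect_marginal (σ : ConsistentSpace) (r : ℕ) :
    SubProb.map (connect r) (marginal σ (r + 1)) = marginal σ r := σ.2 (r + 1)

theorem connect_comp_proj (r : ℕ) : (connect r).comp (proj (r + 1)) = proj r :=
  ContinuousMap.ext fun σ => connect_proj r σ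

/-- The sequence of marginals of a measure on `M`. -/
noncomputable def ofMeasureSeq (μ : SubProb ConsistentSpace) : (r : ℕ) → IterSpace r
  | 0 => IterSpace.point
  | r + 1 => (SubProb.map (proj r) μ : SubProb (IterSpace r))

/-- The consistent sequence of marginals of a measure on `M`. -/
noncomputable def ofMeasure : C(SubProb ConsistentSpace, ConsistentSpace) where
  toFun μ := ⟨ofMeasureSeq μ, fun r => by
    cases r with
    | zero => exact Subsingleton.elim _ _
    | succ r =>
      change SubProb.map (connect r) (SubProb.map (proj (r + 1)) μ) = SubProb.map (proj r) μ
      rw [SubProb.map_map, connect_comp_proj]⟩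
  continuous_toFun := Continuous.subtype_mk (continuous_pi fun r => by
    cases r with
    | zero => exact continuous_const
    | succ r => exact (SubProb.map (proj r)).continuous) _

theorem marginal_ofMeasure (μ : SubProb ConsistentSpace) (r : ℕ) :
    marginal (ofMeasure μ) r = SubProb.map (proj r) μ := rfl

/-- A continuous section of the projection `M → M_r`. -/
noncomputable def lift : (r : ℕ) → C(IterSpace r, ConsistentSpace)
  | 0 => ContinuousMap.const _ (ofMeasure 0)
  | r + 1 => ofMeasure.comp (SubProb.map (lift r))

theorem proj_comp_lift (r : ℕ) : (proj r).comp (lift r) = ContinuousMap.id _ := by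
  induction r with
  | zero => exact ContinuousMap.ext fun x => Subsingleton.elim _ _
  | succ r ih =>
    refine ContinuousMap.ext fun (μ : SubProb (IterSpace r)) => ?_
    have h : SubProb.map (proj r) (SubProb.map (lift r) μ) = μ := by
      rw [SubProb.map_map, ih, SubProb.map_id]
    exact h

theorem map_proj_map_lift (σ : ConsistentSpace) (k m : ℕ) :
    SubProb.map (proj k) (SubProb.map (lift (k + m)) (marginal σ (k + m))) = marginal σ k := by
  induction m generalizing k with
  | zero =>
    rw [SubProb.map_map]
    change SubProb.map ((proj k).comp (lift k)) (marginal σ k) = _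
    rw [proj_comp_lift, SubProb.map_id]
  | succ m ih =>
    have h := ih (k + 1)
    rw [show k + 1 + m = k + (m + 1) by omega] at h
    rw [← connect_comp_proj, ← SubProb.map_map, h, map_connect_marginal]

/-- Every consistent sequence is the sequence of marginals of a measure on `M`. -/
theorem exists_measure (σ : ConsistentSpace) :
    ∃ μ : SubProb ConsistentSpace, ∀ r, SubProb.map (proj r) μ = marginal σ r := by
  obtain ⟨μ, hμ⟩ := exists_clusterPt_of_compactSpace
    (map (fun r => SubProb.map (lift r) (marginal σ r)) atTop)
  refine ⟨μ, fun k => ?_⟩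
  have h1 : ClusterPt (SubProb.map (proj k) μ)
      (map (SubProb.map (proj k)) (map (fun r => SubProb.map (lift r) (marginal σ r)) atTop)) :=
    hμ.map (SubProb.map (proj k)).continuous.continuousAt tendsto_map
  have h2 : Tendsto (SubProb.map (proj k))
      (map (fun r => SubProb.map (lift r) (marginal σ r)) atTop) (𝓝 (marginal σ k)) := by
    rw [tendsto_map'_iff]
    refine tendsto_const_nhds.congr' ?_
    filter_upwards [eventually_ge_atTop k] with r hr
    obtain ⟨m, rfl⟩ := Nat.exists_eq_add_of_le hr
    exact (map_proj_map_lift σ k m).symm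
  exact eq_of_nhds_neBot (ClusterPt.mono h1 h2)

theorem measurableSpace_eq :
    (inferInstance : MeasurableSpace ConsistentSpace) = MeasurableSpace.generateFrom
      {s | ∃ (r : ℕ) (A : Set (IterSpace r)), MeasurableSet A ∧ proj r ⁻¹' A = s} := by
  have h : (inferInstance : MeasurableSpace ConsistentSpace) =
      MeasurableSpace.comap Subtype.val MeasurableSpace.pi :=
    (BorelSpace.measurable_eq (α := {σ : (r : ℕ) → IterSpace r //
      ∀ r, connect r (σ (r + 1)) = σ r})).symm
  refine le_antisymm ?_ (MeasurableSpace.generateFrom_le ?_)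
  · rw [h, MeasurableSpace.pi, MeasurableSpace.comap_iSup]
    refine iSup_le fun r => ?_
    rw [MeasurableSpace.comap_comp]
    rintro s ⟨A, hA, rfl⟩
    exact MeasurableSpace.measurableSet_generateFrom ⟨r, A, hA, rfl⟩
  · rintro s ⟨r, A, hA, rfl⟩
    exact (proj r).continuous.measurable hA

theorem cylinder_shift {r n : ℕ} (h : r ≤ n) {A : Set (IterSpace r)} (hA : MeasurableSet A) :
    ∃ B : Set (IterSpace n), MeasurableSet B ∧ proj n ⁻¹' B = proj r ⁻¹' A := by
  induction n, h using Nat.le_induction with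
  | base => exact ⟨A, hA, rfl⟩
  | succ n _ ih =>
    obtain ⟨B, hB, h⟩ := ih
    refine ⟨connect n ⁻¹' B, (connect n).continuous.measurable hB, ?_⟩
    rw [← h, ← connect_comp_proj n]
    rfl

theorem isPiSystem_cylinder : IsPiSystem
    {s | ∃ (r : ℕ) (A : Set (IterSpace r)), MeasurableSet A ∧ proj r ⁻¹' A = s} := by
  rintro _ ⟨r, A, hA, rfl⟩ _ ⟨k, B, hB, rfl⟩ -
  obtain ⟨A', hA', h1⟩ := cylinder_shift (le_max_left r k) hA
  obtain ⟨B', hB', h2⟩ := cylinder_shift (le_max_right r k) hB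
  exact ⟨max r k, A' ∩ B', hA'.inter hB', by rw [← h1, ← h2, Set.preimage_inter]⟩

/-- The measure on `M` extending the marginals `σ_{r+1}` of the consistent sequence `σ`. -/
noncomputable def degMeasure (σ : ConsistentSpace) : SubProb ConsistentSpace :=
  (exists_measure σ).choose

theorem degMeasure_cylinder (σ : ConsistentSpace) (r : ℕ) {A : Set (IterSpace r)}
    (hA : MeasurableSet A) :
    (degMeasure σ).toMeasure (proj r ⁻¹' A) = (marginal σ r).toMeasure A := by
  rw [← (exists_measure σ).choose_spec r, SubProb.toMeasure_map,
    Measure.map_apply (proj r).continuous.measurable hA]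
  rfl

theorem measurable_degMeasure :
    Measurable fun σ : ConsistentSpace => (degMeasure σ).toMeasure := by
  refine Measurable.measure_of_isPiSystem measurableSpace_eq isPiSystem_cylinder ?_ ?_
  · rintro _ ⟨r, A, hA, rfl⟩
    simp only [degMeasure_cylinder _ r hA]
    exact (Measure.measurable_coe hA).comp
      (SubProb.measurable_apply.comp (proj (r + 1)).continuous.measurable)
  · have h : ∀ σ : ConsistentSpace, (degMeasure σ).toMeasure Set.univ =
        (marginal σ 0).toMeasure Set.univ := fun σ =>
      degMeasure_cylinder σ 0 MeasurableSet.univ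
    simp only [h]
    exact (Measure.measurable_coe MeasurableSet.univ).comp
      (SubProb.measurable_apply.comp (proj 1).continuous.measurable)

/-- The canonical sub-Markov kernel on `M`. -/
noncomputable def deg : Kernel ConsistentSpace ConsistentSpace where
  toFun σ := (degMeasure σ).toMeasure
  measurable' := measurable_degMeasure

theorem deg_cylinder (σ : ConsistentSpace) (r : ℕ) {A : Set (IterSpace r)}
    (hA : MeasurableSet A) :
    deg σ (proj r ⁻¹' A) = SubProb.toMeasure (K := IterSpace r) (σ.1 (r + 1)) A :=
  degMeasure_cylinder σ r hA

theorem deg_univ_le (σ : ConsistentSpace) : deg σ Set.univ ≤ 1 :=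
  (degMeasure σ).toMeasure_univ_le

/-- The kernel is determined by its values on cylinder sets. -/
theorem deg_unique (κ : Kernel ConsistentSpace ConsistentSpace)
    (h : ∀ (σ : ConsistentSpace) (r : ℕ) (A : Set (IterSpace r)), MeasurableSet A →
      κ σ (proj r ⁻¹' A) = SubProb.toMeasure (K := IterSpace r) (σ.1 (r + 1)) A) :
    κ = deg := by
  refine Kernel.ext fun σ => ?_
  have hu : deg σ Set.univ = κ σ Set.univ :=
    (deg_cylinder σ 0 MeasurableSet.univ).trans (h σ 0 _ MeasurableSet.univ).symm
  have : IsFiniteMeasure (deg σ) := ⟨(deg_univ_le σ).trans_lt ENNReal.one_lt_top⟩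
  refine (ext_of_generate_finite _ measurableSpace_eq isPiSystem_cylinder ?_ hu).symm
  rintro _ ⟨r, A, hA, rfl⟩
  rw [deg_cylinder σ r hA, h σ r A hA]

end ConsistentSpace

section Trees

variable {W : Type} (F : SimpleGraph W)

/-- The nodes of a rooted labelled tree, in decreasing order of labels; `o` has label `0`. -/
def nodes (o : W) (R : List (W × W)) : List W := R.map Prod.fst ++ [o]

/-- Admissible labellings: `R` lists, in decreasing order of labels, the pairs `(i, j(i))` where
`i` is a node other than the root `o` and `j(i)` is a node with smaller label that is adjacent
to `i`. -/
inductive Admissible (o : W) : List (W × W) → Prop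
  | nil : Admissible o []
  | cons (i j : W) (R : List (W × W)) (hR : Admissible o R) (hi : i ∉ nodes o R)
      (hj : j ∈ nodes o R) (hij : F.Adj i j) : Admissible o ((i, j) :: R)

/-- An admissible labelling of all the nodes of `F`, with the choice of the function `j`. -/
structure AdmissibleLabeling where
  root : W
  rest : List (W × W)
  admissible : Admissible F root rest
  total : ∀ w, w ∈ nodes root rest

variable {F}

theorem mem_nodes_cons {o i j w : W} {R : List (W × W)} :
    w ∈ nodes o ((i, j) :: R) ↔ w = i ∨ w ∈ nodes o R := by
  simp [nodes]

theorem mem_nodes_nil {o w : W} : w ∈ nodes o [] ↔ w = o := by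
  simp [nodes]

theorem Admissible.of_cons {o i j : W} {R : List (W × W)} (h : Admissible F o ((i, j) :: R)) :
    Admissible F o R ∧ i ∉ nodes o R ∧ j ∈ nodes o R ∧ F.Adj i j := by
  cases h with
  | cons _ _ _ hR hi hj hij => exact ⟨hR, hi, hj, hij⟩

theorem Admissible.nodup {o : W} {R : List (W × W)} (h : Admissible F o R) :
    (nodes o R).Nodup := by
  induction h with
  | nil => simp [nodes]
  | cons i j R _ hi _ _ ih => exact List.nodup_cons.2 ⟨hi, ih⟩

theorem root_mem_nodes (o : W) (R : List (W × W)) : o ∈ nodes o R := by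
  simp [nodes]

theorem length_nodes (o : W) (R : List (W × W)) : (nodes o R).length = R.length + 1 := by
  simp [nodes]

/-- Every tree has an admissible labelling. -/
theorem nonempty_admissibleLabeling [Finite W] (hF : F.IsTree) :
    Nonempty (AdmissibleLabeling F) := by
  have := Fintype.ofFinite W
  have := hF.1.nonempty
  let o : W := Classical.arbitrary W
  by_contra hne
  have key : ∀ n, ∃ R, Admissible F o R ∧ R.length = n := by
    intro n
    induction n with
    | zero => exact ⟨[], .nil, rfl⟩
    | succ n ih =>
      obtain ⟨R, hR, hn⟩ := ih
      have h1 : ∃ w, w ∉ nodes o R := by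
        by_contra! h
        exact hne ⟨⟨o, R, hR, h⟩⟩
      obtain ⟨w, hw⟩ := h1
      obtain ⟨p⟩ := hF.1.preconnected o w
      obtain ⟨d, _, hd1, hd2⟩ := p.exists_boundary_dart {w | w ∈ nodes o R}
        (root_mem_nodes o R) hw
      exact ⟨(d.snd, d.fst) :: R, .cons _ _ _ hR hd2 hd1 d.adj.symm, by simp [hn]⟩
  obtain ⟨R, hR, hn⟩ := key (Fintype.card W)
  have := hR.nodup.length_le_card
  rw [length_nodes] at this
  omega

/-- Two nodes of an admissible list are joined by a walk inside the list. -/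
theorem Admissible.exists_walk {o : W} {R : List (W × W)} (h : Admissible F o R) :
    ∀ w ∈ nodes o R, ∃ p : F.Walk w o, ∀ u ∈ p.support, u ∈ nodes o R := by
  induction h with
  | nil =>
    intro w hw
    obtain rfl := mem_nodes_nil.1 hw
    exact ⟨.nil, by simp [nodes]⟩
  | cons i j R _ _ hj hij ih =>
    intro w hw
    rcases mem_nodes_cons.1 hw with rfl | hw
    · obtain ⟨p, hp⟩ := ih j hj
      refine ⟨.cons hij p, fun u hu => ?_⟩
      rw [SimpleGraph.Walk.support_cons, List.mem_cons] at hu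
      exact mem_nodes_cons.2 (hu.imp_right (hp u))
    · obtain ⟨p, hp⟩ := ih w hw
      exact ⟨p, fun u hu => mem_nodes_cons.2 (Or.inr (hp u hu))⟩

/-- In an acyclic graph, a node outside an admissible list has at most one neighbour in it. -/
theorem Admissible.eq_of_adj (hF : F.IsAcyclic) {o : W} {R : List (W × W)}
    (h : Admissible F o R) {i a b : W} (hi : i ∉ nodes o R) (ha : a ∈ nodes o R)
    (hb : b ∈ nodes o R) (hia : F.Adj i a) (hib : F.Adj i b) : a = b := by
  classical
  obtain ⟨p, hp⟩ := h.exists_walk a ha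
  obtain ⟨q, hq⟩ := h.exists_walk b hb
  let r : F.Path a b := (p.append q.reverse).toPath
  have hr : i ∉ (r : F.Walk a b).support := by
    intro hmem
    have h1 := SimpleGraph.Walk.support_toPath_subset_support (p.append q.reverse) hmem
    rw [SimpleGraph.Walk.mem_support_append_iff, SimpleGraph.Walk.support_reverse,
      List.mem_reverse] at h1
    exact hi (h1.elim (hp i) (hq i))
  have := hF.subsingleton_path i b
  have h2 : (⟨.cons hia r, r.2.cons hr⟩ : F.Path i b) = SimpleGraph.Path.singleton hib :=
    Subsingleton.elim _ _
  have h3 := congrArg (fun P : F.Path i b => (P : F.Walk i b).snd) h2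
  simpa using h3

theorem Admissible.exists_adj {o : W} {R : List (W × W)} (h : Admissible F o R) (hR : R ≠ []) :
    ∀ v ∈ nodes o R, ∃ u ∈ nodes o R, F.Adj v u := by
  induction h with
  | nil => exact absurd rfl hR
  | cons i j R _ _ hj hij ih =>
    intro v hv
    rcases mem_nodes_cons.1 hv with rfl | hv
    · exact ⟨j, mem_nodes_cons.2 (Or.inr hj), hij⟩
    · by_cases hR' : R = []
      · subst hR'
        rw [mem_nodes_nil] at hv hj
        subst hv hj
        exact ⟨i, mem_nodes_cons.2 (Or.inl rfl), hij.symm⟩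
      · obtain ⟨u, hu, huv⟩ := ih hR' v hv
        exact ⟨u, mem_nodes_cons.2 (Or.inr hu), huv⟩

/-- A node with a single neighbour can be removed from an admissible list. -/
theorem Admissible.remove {o : W} {R : List (W × W)} (h : Admissible F o R) (hR : R ≠ [])
    {l : W} (hl : l ∈ nodes o R)
    (hu : ∀ u ∈ nodes o R, ∀ v ∈ nodes o R, F.Adj l u → F.Adj l v → u = v) :
    ∃ o' R', Admissible F o' R' ∧ l ∉ nodes o' R' ∧
      ∀ w, w ∈ nodes o R ↔ w = l ∨ w ∈ nodes o' R' := by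
  induction h with
  | nil => exact absurd rfl hR
  | cons i j R hA hi hj hij ih =>
    by_cases hli : l = i
    · subst hli
      exact ⟨o, R, hA, hi, fun w => mem_nodes_cons⟩
    have hlR : l ∈ nodes o R := (mem_nodes_cons.1 hl).resolve_left hli
    by_cases hR' : R = []
    · subst hR'
      rw [mem_nodes_nil] at hlR
      subst hlR
      refine ⟨i, [], .nil, fun h => hli (mem_nodes_nil.1 h), fun w => ?_⟩
      rw [mem_nodes_cons, mem_nodes_nil, mem_nodes_nil, or_comm]
    · obtain ⟨o', R', hA', hl', hw'⟩ := ih hR' hlR fun u hu1 v hv1 =>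
        hu u (mem_nodes_cons.2 (Or.inr hu1)) v (mem_nodes_cons.2 (Or.inr hv1))
      have hjl : j ≠ l := by
        rintro rfl
        obtain ⟨u, hu1, hu2⟩ := hA.exists_adj hR' j hj
        have := hu u (mem_nodes_cons.2 (Or.inr hu1)) i (mem_nodes_cons.2 (Or.inl rfl)) hu2 hij.symm
        exact hi (this ▸ hu1)
      have hi' : i ∉ nodes o' R' := fun h => hi ((hw' i).2 (Or.inr h))
      refine ⟨o', (i, j) :: R', .cons i j R' hA' hi' (((hw' j).1 hj).resolve_left hjl) hij, ?_, ?_⟩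
      · rw [mem_nodes_cons]
        exact not_or.2 ⟨hli, hl'⟩
      · intro w
        rw [mem_nodes_cons, mem_nodes_cons, hw' w]
        tauto

theorem Admissible.exists_cons {o : W} {R : List (W × W)} (h : Admissible F o R) (hR : R ≠ [])
    {l b : W} (hl : l ∈ nodes o R) (hb : b ∈ nodes o R) (hlb : F.Adj l b)
    (hu : ∀ u ∈ nodes o R, ∀ v ∈ nodes o R, F.Adj l u → F.Adj l v → u = v) :
    ∃ o' R', Admissible F o' ((l, b) :: R') ∧
      ∀ w, w ∈ nodes o R ↔ w ∈ nodes o' ((l, b) :: R') := by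
  obtain ⟨o', R', hA, hl', hw⟩ := h.remove hR hl hu
  exact ⟨o', R', .cons l b R' hA hl' (((hw b).1 hb).resolve_left hlb.ne') hlb,
    fun w => (hw w).trans mem_nodes_cons.symm⟩

variable {X : Type*} [MeasurableSpace X] (κ : Kernel X X)

open Classical in
/-- The iterated integral
`∫ ⋯ ∫ h(x) dκ(x_{j(n)})(x_n) ⋯ dκ(x_{j(1)})(x_1)` over the nodes of the list `R`. -/
noncomputable def iterIntegral : List (W × W) → ((W → X) → ℝ≥0∞) → (W → X) → ℝ≥0∞
  | [], h => h
  | (i, j) :: R, h =>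
    iterIntegral R fun x => ∫⁻ y, h (Function.update x i y) ∂κ (x j)

/-- The rooted density of a labelled tree at `x₀`. -/
noncomputable def rootedDensity (L : AdmissibleLabeling F) (x₀ : X) : ℝ≥0∞ :=
  iterIntegral κ L.rest (fun _ => 1) fun _ => x₀

/-- The density of a labelled tree. -/
noncomputable def labeledDensity (π : Measure X) (L : AdmissibleLabeling F) : ℝ≥0∞ :=
  ∫⁻ x, rootedDensity κ L x ∂π

/-- The density `t(F, (X, π, κ))` of a finite tree `F` in a probability space `(X, π)` with a
reversible sub-Markov kernel `κ`. It does not depend on the labelling of `F`, see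
`labeledDensity_eq`. -/
noncomputable def treeDensity [Finite W] (π : Measure X) (hF : F.IsTree) : ℝ≥0∞ :=
  labeledDensity κ π (nonempty_admissibleLabeling hF).some

/-- The integral with a weight at each node. -/
noncomputable def weighted (π : Measure X) (o : W) (R : List (W × W)) (g : W → X → ℝ≥0∞) :
    ℝ≥0∞ :=
  ∫⁻ x₀, iterIntegral κ R (fun x => ((nodes o R).map fun w => g w (x w)).prod) (fun _ => x₀) ∂π

open Classical in
/-- The weights after integrating out the node `i` with neighbour `j`. -/
noncomputable def absorb (i j : W) (g : W → X → ℝ≥0∞) : W → X → ℝ≥0∞ :=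
  Function.update g j fun x => g j x * ∫⁻ y, g i y ∂κ x

theorem measurable_absorb {i j : W} {g : W → X → ℝ≥0∞} (hg : ∀ w, Measurable (g w)) (w : W) :
    Measurable (absorb κ i j g w) := by
  classical
  unfold absorb
  by_cases h : w = j
  · subst h
    rw [Function.update_self]
    exact (hg w).mul (hg i).lintegral_kernel
  · rw [Function.update_of_ne h]
    exact hg w

theorem prod_absorb (i j : W) (g : W → X → ℝ≥0∞) (x : W → X) (S : List W) (hS : S.Nodup)
    (hj : j ∈ S) :
    (S.map fun w => absorb κ i j g w (x w)).prod =
      (S.map fun w => g w (x w)).prod * ∫⁻ y, g i y ∂κ (x j) := by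
  classical
  have h0 : ∀ S : List W, j ∉ S →
      (S.map fun w => absorb κ i j g w (x w)) = S.map fun w => g w (x w) := by
    intro S hS
    refine List.map_congr_left fun w hw => ?_
    have : w ≠ j := fun h => hS (h ▸ hw)
    rw [absorb, Function.update_of_ne this]
  induction S with
  | nil => simp at hj
  | cons a S ih =>
    rw [List.nodup_cons] at hS
    rw [List.map_cons, List.map_cons, List.prod_cons, List.prod_cons]
    by_cases ha : j = a
    · subst ha
      rw [h0 S hS.1, absorb, Function.update_self]
      ring
    · rw [ih hS.2 ((List.mem_cons.1 hj).resolve_left ha), absorb,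
        Function.update_of_ne (Ne.symm ha)]
      ring

theorem weighted_cons (π : Measure X) {o i j : W} {R : List (W × W)}
    (h : Admissible F o ((i, j) :: R)) {g : W → X → ℝ≥0∞} (hg : ∀ w, Measurable (g w)) :
    weighted κ π o ((i, j) :: R) g = weighted κ π o R (absorb κ i j g) := by
  classical
  obtain ⟨hR, hi, hj, hij⟩ := h.of_cons
  · unfold weighted
    refine lintegral_congr fun x₀ => ?_
    rw [iterIntegral]
    congr 1
    funext x
    rw [prod_absorb κ i j g x _ hR.nodup hj]
    have h1 : ∀ y, ((nodes o ((i, j) :: R)).map fun w => g w (Function.update x i y w)).prod =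
        ((nodes o R).map fun w => g w (x w)).prod * g i y := by
      intro y
      change ((i :: nodes o R).map fun w => g w (Function.update x i y w)).prod = _
      rw [List.map_cons, List.prod_cons, Function.update_self, mul_comm]
      congr 2
      refine List.map_congr_left fun w hw => ?_
      have : w ≠ i := fun h => hi (h ▸ hw)
      rw [Function.update_of_ne this]
    simp only [h1]
    rw [lintegral_const_mul _ (hg i)]

variable {κ}

theorem lintegral_swap_of_indicator {π : Measure X} {f g : X → ℝ≥0∞}
    (hf : Measurable f) (hg : Measurable g)
    (h : ∀ (c : ℝ≥0∞) (A : Set X), MeasurableSet A →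
      ∫⁻ x, A.indicator (fun _ => c) x * ∫⁻ y, g y ∂κ x ∂π =
        ∫⁻ x, g x * ∫⁻ y, A.indicator (fun _ => c) y ∂κ x ∂π) :
    ∫⁻ x, f x * ∫⁻ y, g y ∂κ x ∂π = ∫⁻ x, g x * ∫⁻ y, f y ∂κ x ∂π := by
  refine Measurable.ennreal_induction (motive := fun f : X → ℝ≥0∞ =>
    ∫⁻ x, f x * ∫⁻ y, g y ∂κ x ∂π = ∫⁻ x, g x * ∫⁻ y, f y ∂κ x ∂π)
    (fun c A hA => h c A hA) ?_ ?_ hf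
  · intro f₁ f₂ _ h1 h2 ih1 ih2
    simp only [Pi.add_apply]
    simp_rw [lintegral_add_left h1, mul_add, add_mul]
    rw [lintegral_add_left, lintegral_add_left, ih1, ih2]
    · exact hg.mul h1.lintegral_kernel
    · exact h1.mul hg.lintegral_kernel
  · intro f hf hmono ih
    have hm1 : ∀ x, Monotone fun n => f n x := fun x m n h => hmono h x
    simp_rw [lintegral_iSup hf hmono, ENNReal.mul_iSup, ENNReal.iSup_mul]
    rw [lintegral_iSup, lintegral_iSup]
    · exact iSup_congr ih
    · exact fun n => hg.mul (hf n).lintegral_kernel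
    · exact fun m n h x => mul_le_mul_right (lintegral_mono fun y => hm1 y h) _
    · exact fun n => (hf n).mul hg.lintegral_kernel
    · exact fun m n h x => mul_le_mul_left (hm1 x h) _

theorem reversible_lintegral {π : Measure X} (hκ : κ.IsReversible π) {f g : X → ℝ≥0∞}
    (hf : Measurable f) (hg : Measurable g) :
    ∫⁻ x, f x * ∫⁻ y, g y ∂κ x ∂π = ∫⁻ x, g x * ∫⁻ y, f y ∂κ x ∂π := by
  have h : ∀ (c d : ℝ≥0∞) (A B : Set X), MeasurableSet A → MeasurableSet B →
      ∫⁻ x, A.indicator (fun _ => c) x * ∫⁻ y, B.indicator (fun _ => d) y ∂κ x ∂π =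
        c * d * ∫⁻ x in A, κ x B ∂π := by
    intro c d A B hA hB
    rw [← lintegral_indicator hA, ← lintegral_const_mul _
      ((κ.measurable_coe hB).indicator hA)]
    refine lintegral_congr fun x => ?_
    rw [lintegral_indicator_const hB]
    by_cases hx : x ∈ A <;> simp [hx, mul_assoc]
  refine lintegral_swap_of_indicator hf hg fun c A hA => ?_
  refine (lintegral_swap_of_indicator hg (measurable_const.indicator hA) fun d B hB => ?_).symm
  rw [h c d A B hA hB, h d c B A hB hA, hκ hA hB, mul_comm c d]

theorem absorb_comm {i j k l : W} (hj : j ≠ k) (hl : l ≠ i) (g : W → X → ℝ≥0∞) :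
    absorb κ k l (absorb κ i j g) = absorb κ i j (absorb κ k l g) := by
  classical
  funext w x
  have h1 : absorb κ i j g k = g k := by rw [absorb, Function.update_of_ne (Ne.symm hj)]
  have h2 : absorb κ k l g i = g i := by rw [absorb, Function.update_of_ne (Ne.symm hl)]
  rw [absorb, absorb.eq_1 κ i j (absorb κ k l g), h1, h2]
  by_cases hlj : l = j
  · subst hlj
    by_cases hw : w = l
    · subst hw
      simp only [Function.update_self, absorb]
      ring
    · simp only [Function.update_of_ne hw, absorb]
  · by_cases hw : w = l
    · subst hw
      simp only [Function.update_self, Function.update_of_ne hlj, absorb]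
    · by_cases hw' : w = j
      · subst hw'
        simp only [Function.update_self, Function.update_of_ne hw, absorb]
      · simp only [Function.update_of_ne hw, Function.update_of_ne hw', absorb]

theorem iff_of_remove_two {p q a b c d : Prop} (h1 : p ∨ a ↔ q ∨ b) (h2 : a ↔ q ∨ c)
    (h3 : b ↔ p ∨ d) (ha : p → ¬a) (hb : q → ¬b) (hc : q → ¬c) (hd : p → ¬d) : c ↔ d := by
  by_cases hp : p <;> by_cases hq : q <;> simp_all

theorem weighted_eq {π : Measure X} (hκ : κ.IsReversible π) (hF : F.IsAcyclic) (n : ℕ) :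
    ∀ (o o' : W) (R R' : List (W × W)) (g : W → X → ℝ≥0∞), R.length ≤ n →
      Admissible F o R → Admissible F o' R' → (∀ w, w ∈ nodes o R ↔ w ∈ nodes o' R') →
      (∀ w, Measurable (g w)) → weighted κ π o R g = weighted κ π o' R' g := by
  induction n with
  | zero =>
    intro o o' R R' g hn hA hA' hw _
    have hlen := ((List.perm_ext_iff_of_nodup hA.nodup hA'.nodup).2 hw).length_eq
    rw [length_nodes, length_nodes] at hlen
    obtain rfl := List.length_eq_zero_iff.1 (Nat.le_zero.1 hn)
    obtain rfl := List.length_eq_zero_iff.1 (by simpa using hlen.symm : R'.length = 0)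
    obtain rfl := mem_nodes_nil.1 ((hw o).1 (mem_nodes_nil.2 rfl))
    rfl
  | succ n ih =>
    intro o o' R R' g hn hA hA' hw hg
    have hlen := ((List.perm_ext_iff_of_nodup hA.nodup hA'.nodup).2 hw).length_eq
    rw [length_nodes, length_nodes] at hlen
    obtain _ | ⟨⟨i, j⟩, R⟩ := R
    · exact ih _ _ _ _ _ (Nat.zero_le _) hA hA' hw hg
    obtain _ | ⟨⟨k, l⟩, R'⟩ := R'
    · simp at hlen
    simp only [List.length_cons, Nat.add_right_cancel_iff, Nat.add_le_add_iff_right] at hn hlen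
    rw [weighted_cons κ π hA hg, weighted_cons κ π hA' hg]
    obtain ⟨hR, hi, hj, hij⟩ := hA.of_cons
    obtain ⟨hR', hk, hl, hkl⟩ := hA'.of_cons
    by_cases hik : i = k
    · subst hik
      have hw' : ∀ w, w ∈ nodes o R ↔ w ∈ nodes o' R' := by
        intro w
        have h1 := hw w
        rw [mem_nodes_cons, mem_nodes_cons] at h1
        by_cases hwi : w = i
        · rw [hwi]
          exact iff_of_false hi hk
        · simpa [hwi] using h1
      obtain rfl := hR.eq_of_adj hF hi hj ((hw' l).2 hl) hij hkl
      exact ih _ _ _ _ _ hn hR hR' hw' (measurable_absorb κ hg)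
    · have hkR : k ∈ nodes o R :=
        (mem_nodes_cons.1 ((hw k).2 (mem_nodes_cons.2 (Or.inl rfl)))).resolve_left (Ne.symm hik)
      have hiR' : i ∈ nodes o' R' :=
        (mem_nodes_cons.1 ((hw i).1 (mem_nodes_cons.2 (Or.inl rfl)))).resolve_left hik
      by_cases hRe : R = []
      · subst hRe
        obtain rfl := List.length_eq_zero_iff.1 (by simpa using hlen.symm : R'.length = 0)
        rw [mem_nodes_nil] at hj hl hkR hiR'
        subst hj hl hkR hiR'
        have h1 : ∀ (a b : W), weighted κ π a [] (absorb κ b a g) =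
            ∫⁻ x, g a x * ∫⁻ y, g b y ∂κ x ∂π := by
          intro a b
          simp [weighted, iterIntegral, nodes, absorb]
        rw [h1, h1]
        exact reversible_lintegral hκ (hg _) (hg _)
      · have hR'e : R' ≠ [] := by
          rintro rfl
          exact hRe (List.length_eq_zero_iff.1 (by simpa using hlen))
        -- the nodes `i` and `k` are leaves
        have hi1 : ∀ u ∈ nodes o' R', ∀ v ∈ nodes o' R', F.Adj i u → F.Adj i v → u = v := by
          have h1 : ∀ u ∈ nodes o' R', F.Adj i u → u ∈ nodes o R := fun u hu h =>
            (mem_nodes_cons.1 ((hw u).2 (mem_nodes_cons.2 (Or.inr hu)))).resolve_left h.ne'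
          exact fun u hu v hv h2 h3 => hR.eq_of_adj hF hi (h1 u hu h2) (h1 v hv h3) h2 h3
        have hk1 : ∀ u ∈ nodes o R, ∀ v ∈ nodes o R, F.Adj k u → F.Adj k v → u = v := by
          have h1 : ∀ u ∈ nodes o R, F.Adj k u → u ∈ nodes o' R' := fun u hu h =>
            (mem_nodes_cons.1 ((hw u).1 (mem_nodes_cons.2 (Or.inr hu)))).resolve_left h.ne'
          exact fun u hu v hv h2 h3 => hR'.eq_of_adj hF hk (h1 u hu h2) (h1 v hv h3) h2 h3
        have hjk : j ≠ k := by
          rintro rfl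
          obtain ⟨u, hu, huj⟩ := hR.exists_adj hRe j hj
          have hu' : u ∈ nodes o' R' :=
            (mem_nodes_cons.1 ((hw u).1 (mem_nodes_cons.2 (Or.inr hu)))).resolve_left huj.ne'
          exact hi ((hR'.eq_of_adj hF hk hu' hiR' huj hij.symm) ▸ hu)
        have hli : l ≠ i := by
          rintro rfl
          obtain ⟨u, hu, huj⟩ := hR'.exists_adj hR'e l hl
          have hu' : u ∈ nodes o R :=
            (mem_nodes_cons.1 ((hw u).2 (mem_nodes_cons.2 (Or.inr hu)))).resolve_left huj.ne'
          exact hk ((hR.eq_of_adj hF hi hu' hkR huj hkl.symm) ▸ hu)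
        have hlR : l ∈ nodes o R :=
          (mem_nodes_cons.1 ((hw l).2 (mem_nodes_cons.2 (Or.inr hl)))).resolve_left hli
        have hjR' : j ∈ nodes o' R' :=
          (mem_nodes_cons.1 ((hw j).1 (mem_nodes_cons.2 (Or.inr hj)))).resolve_left hjk
        obtain ⟨o₂, R₂, hA₂, hw₂⟩ := hR.exists_cons hRe hkR hlR hkl hk1
        obtain ⟨o₃, R₃, hA₃, hw₃⟩ := hR'.exists_cons hR'e hiR' hjR' hij hi1
        have hm := measurable_absorb κ (i := i) (j := j) hg
        have hm' := measurable_absorb κ (i := k) (j := l) hg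
        rw [ih _ _ _ _ _ hn hR hA₂ hw₂ hm, ih _ _ _ _ _ (by omega) hR' hA₃ hw₃ hm',
          weighted_cons κ π hA₂ hm, weighted_cons κ π hA₃ hm', absorb_comm hjk hli]
        have hl₂ := ((List.perm_ext_iff_of_nodup hR.nodup hA₂.nodup).2 hw₂).length_eq
        rw [length_nodes, length_nodes, List.length_cons] at hl₂
        obtain ⟨hR₂, hk₂, _, _⟩ := hA₂.of_cons
        obtain ⟨hR₃, hi₃, _, _⟩ := hA₃.of_cons
        have hw23 : ∀ w, w ∈ nodes o₂ R₂ ↔ w ∈ nodes o₃ R₃ := by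
          intro w
          have h1 := hw w
          have h2 := hw₂ w
          have h3 := hw₃ w
          rw [mem_nodes_cons] at h2 h3
          rw [mem_nodes_cons, mem_nodes_cons] at h1
          exact iff_of_remove_two h1 h2 h3 (fun h => h ▸ hi) (fun h => h ▸ hk)
            (fun h => h ▸ hk₂) (fun h => h ▸ hi₃)
        exact ih _ _ _ _ _ (by omega) hR₂ hR₃ hw23 (measurable_absorb κ hm')

/-- The density of a tree does not depend on the labelling, in particular not on the root. -/
theorem labeledDensity_eq {π : Measure X} (hκ : κ.IsReversible π) (hF : F.IsAcyclic)
    (L L' : AdmissibleLabeling F) : labeledDensity κ π L = labeledDensity κ π L' := by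
  have h : ∀ L : AdmissibleLabeling F,
      labeledDensity κ π L = weighted κ π L.root L.rest fun _ _ => 1 := by
    intro L
    simp [labeledDensity, rootedDensity, weighted]
  rw [h, h]
  exact weighted_eq hκ hF _ _ _ _ _ _ le_rfl L.admissible L'.admissible
    (fun w => iff_of_true (L.total w) (L'.total w)) fun _ => measurable_const

theorem treeDensity_eq [Finite W] {π : Measure X} (hκ : κ.IsReversible π) (hF : F.IsTree)
    (L : AdmissibleLabeling F) : treeDensity κ π hF = labeledDensity κ π L :=
  labeledDensity_eq hκ hF.2 _ _

theorem iterIntegral_le_one (hκ : ∀ x, κ x Set.univ ≤ 1) (R : List (W × W))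
    (h : (W → X) → ℝ≥0∞) (hh : ∀ x, h x ≤ 1) (x : W → X) : iterIntegral κ R h x ≤ 1 := by
  induction R generalizing h with
  | nil => exact hh x
  | cons e R ih =>
    obtain ⟨i, j⟩ := e
    refine ih _ fun x => ?_
    calc _ ≤ ∫⁻ _, 1 ∂κ (x j) := lintegral_mono fun y => hh _
      _ ≤ 1 := by simpa using hκ (x j)

theorem treeDensity_le_one [Finite W] (hκ : ∀ x, κ x Set.univ ≤ 1) (π : Measure X)
    [IsProbabilityMeasure π] (hF : F.IsTree) : treeDensity κ π hF ≤ 1 := by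
  calc treeDensity κ π hF ≤ ∫⁻ _, 1 ∂π :=
        lintegral_mono fun x => iterIntegral_le_one hκ _ _ (fun _ => le_rfl) _
    _ ≤ 1 := by simp

end Trees

/-- `(G, d)` is an admissible pair: `d ≥ 1` and all degrees of `G` are at most `d`. -/
def IsAdmissiblePair {V : Type*} (G : SimpleGraph V) (d : ℝ) : Prop :=
  1 ≤ d ∧ ∀ v, ((G.neighborSet v).ncard : ℝ) ≤ d

/-- The homomorphism density `t(F, G, d) = hom(F, G) / (|V(G)| d ^ (|V(F)| - 1))` of a finite
connected graph `F` in `(G, d)`. -/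
noncomputable def homDensity {W : Type} {V : Type*} (F : SimpleGraph W) (G : SimpleGraph V)
    (d : ℝ) : ℝ :=
  (Nat.card (F →g G) : ℝ) / ((Nat.card V : ℝ) * d ^ (Nat.card W - 1))

end GraphLimit

/-! Existence. A vertex `v` of a graph with degree bound `d` is sent to the point `embed v` of M
whose level `r + 1` is `d⁻¹` times the sum of the Dirac masses at the level-`r` images of its
neighbours. Then `deg (embed v)` is `d⁻¹` times the sum of the Dirac masses at the images of the
neighbours (`deg_embed`). Hence the law of the image of a uniform vertex is reversible, by symmetry
of adjacency (`isReversible_nodeMeasure`), and its tree densities are the homomorphism densities of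
the graph (`treeDensity_nodeMeasure`). Probability measures on the compact space M form a compact
space, so these laws have a limit along an ultrafilter.

The limit inherits both properties because `deg` is a Feller kernel: taking marginals is a
continuous bijection from the sub-probability measures on M onto M, hence a homeomorphism, and its
inverse is `deg` (`continuous_degMeasure`). So `deg` preserves continuous functions, each tree
density is the integral of a fixed continuous function (`exists_treeDensity_eq`), and reversibility,
which can be tested on continuous functions, is a closed condition (`isReversible_of_tendsto`).

Uniqueness. The rooted tree densities are continuous functions on M, contain `1`, and are closed
under products, since trees can be glued at their roots. They separate points: a point of M_{r+1} is
a measure on M_r, and by induction and Stone–Weierstrass it is determined by the integrals of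
densities on M_r, which are themselves densities on M_{r+1} (`densAt_separates`). Stone–Weierstrass
on M then shows that a measure is determined by the integrals of all rooted densities
(`measure_eq_of_dens`). For a reversible measure these are the tree densities, as the choice of root
is immaterial (`eq_of_treeDensity_eq`). -/

namespace GraphLimit

/-! ### Measures determined by moments -/

/-- A separating family of continuous functions that is closed under products and contains `1`
determines finite measures on a compact metrizable space. -/
theorem measure_eq_of_moments {K ι : Type*} [TopologicalSpace K] [CompactSpace K]
    [TopologicalSpace.MetrizableSpace K] [MeasurableSpace K] [BorelSpace K]
    (f : ι → C(K, ℝ≥0)) (hone : ∃ i, f i = 1) (hmul : ∀ i j, ∃ k, f k = f i * f j)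
    (hsep : ∀ x y, (∀ i, f i x = f i y) → x = y) {μ ν : Measure K} [IsFiniteMeasure μ]
    [IsFiniteMeasure ν] (h : ∀ i, ∫⁻ x, f i x ∂μ = ∫⁻ x, f i x ∂ν) : μ = ν := by
  let F : ι → C(K, ℝ) := fun i => ⟨fun x => (f i x : ℝ), by fun_prop⟩
  -- The family is already multiplicatively closed, so the algebra it generates is its linear span,
  -- and equality of integrals extends to that algebra by linearity alone.
  let S : Submonoid C(K, ℝ) :=
    { carrier := Set.range F
      one_mem' := by
        obtain ⟨i, hi⟩ := hone
        exact ⟨i, by ext x; simp [F, hi]⟩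
      mul_mem' := by
        rintro _ _ ⟨i, rfl⟩ ⟨j, rfl⟩
        obtain ⟨k, hk⟩ := hmul i j
        exact ⟨k, by ext x; simp [F, hk]⟩ }
  have hcont : ∀ (ρ : Measure K) [IsFiniteMeasure ρ],
      Continuous fun g : C(K, ℝ) => ∫ x, g x ∂ρ := by
    intro ρ _
    have h1 : (fun g : C(K, ℝ) => ∫ x, g x ∂ρ) =
        fun g => ∫ x, ContinuousMap.toLp (E := ℝ) 1 ρ ℝ g x ∂ρ := by
      funext g
      exact (integral_congr_ae (ContinuousMap.coeFn_toLp ρ g)).symm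
    rw [h1]
    exact continuous_integral.comp (ContinuousMap.toLp (E := ℝ) 1 ρ ℝ).continuous
  have hint : ∀ (ρ : Measure K) [IsFiniteMeasure ρ] (g : C(K, ℝ)), Integrable (fun x => g x) ρ :=
    fun ρ _ g => (BoundedContinuousFunction.mkOfCompact g).integrable ρ
  let A : Subalgebra ℝ C(K, ℝ) := Algebra.adjoin ℝ (Set.range F)
  have hA : ∀ g ∈ A, ∫ x, g x ∂μ = ∫ x, g x ∂ν := by
    intro g hg
    have hg' : g ∈ Submodule.span ℝ (Submonoid.closure (Set.range F) : Set C(K, ℝ)) := by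
      rw [← Algebra.adjoin_eq_span]
      exact hg
    induction hg' using Submodule.span_induction with
    | mem g hg1 =>
      obtain ⟨i, rfl⟩ := (Submonoid.closure_le (S := S)).2 subset_rfl hg1
      simp only [F, ContinuousMap.coe_mk]
      have h1 : ∀ (ρ : Measure K), ∫ x, (f i x : ℝ) ∂ρ = (∫⁻ x, f i x ∂ρ).toReal := by
        intro ρ
        rw [integral_eq_lintegral_of_nonneg_ae (ae_of_all _ fun x => NNReal.coe_nonneg _)
          (by fun_prop)]
        simp
      rw [h1, h1, h]
    | zero => simp
    | add g₁ g₂ h1 h2 ih1 ih2 =>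
      simp only [ContinuousMap.add_apply]
      have h1' := (Algebra.adjoin_eq_span ℝ (Set.range F)).ge h1
      have h2' := (Algebra.adjoin_eq_span ℝ (Set.range F)).ge h2
      rw [integral_add (hint _ _) (hint _ _), integral_add (hint _ _) (hint _ _), ih1 h1', ih2 h2']
    | smul c g h1 ih1 =>
      have h1' := (Algebra.adjoin_eq_span ℝ (Set.range F)).ge h1
      simp only [ContinuousMap.smul_apply, integral_smul]
      rw [ih1 h1']
  have hsepA : A.SeparatesPoints := by
    intro x y hxy
    by_contra hne
    push Not at hne
    refine hxy (hsep x y fun i => ?_)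
    have := hne _ ⟨F i, Algebra.subset_adjoin ⟨i, rfl⟩, rfl⟩
    exact NNReal.coe_injective this
  have htop := ContinuousMap.subalgebra_topologicalClosure_eq_top_of_separatesPoints A hsepA
  refine ext_of_forall_integral_eq_of_IsFiniteMeasure fun g => ?_
  -- Integration against a finite measure is continuous in the uniform norm, so equality on the
  -- algebra passes to its closure, which is everything.
  have hcl : IsClosed {g : C(K, ℝ) | ∫ x, g x ∂μ = ∫ x, g x ∂ν} :=
    isClosed_eq (hcont μ) (hcont ν)
  have hmem : g.toContinuousMap ∈ A.topologicalClosure := htop ▸ Algebra.mem_top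
  exact closure_minimal (t := {g : C(K, ℝ) | ∫ x, g x ∂μ = ∫ x, g x ∂ν}) hA hcl hmem

/-! ### Integration as a continuous function of the measure -/

namespace SubProb

variable {K L : Type} [TopologicalSpace K] [MeasurableSpace K] [BorelSpace K] [CompactSpace K]
  [TopologicalSpace L] [MeasurableSpace L] [BorelSpace L] [CompactSpace L]

/-- The integral of a continuous function, as a continuous function of the measure. -/
noncomputable def integ (g : C(K, ℝ≥0)) : C(SubProb K, ℝ≥0) where
  toFun μ := μ.1.testAgainstNN (BoundedContinuousFunction.mkOfCompact g)
  continuous_toFun :=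
    (FiniteMeasure.continuous_testAgainstNN_eval _).comp continuous_subtype_val

theorem coe_integ (g : C(K, ℝ≥0)) (μ : SubProb K) :
    (integ g μ : ℝ≥0∞) = ∫⁻ x, g x ∂μ.toMeasure :=
  FiniteMeasure.testAgainstNN_coe_eq

theorem integ_map (f : C(K, L)) (g : C(L, ℝ≥0)) (μ : SubProb K) :
    integ g (map f μ) = integ (g.comp f) μ := by
  rw [← ENNReal.coe_inj, coe_integ, coe_integ, toMeasure_map,
    lintegral_map (by fun_prop) f.continuous.measurable]
  rfl

end SubProb

/-! ### M as the space of sub-probability measures on itself -/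

namespace ConsistentSpace

theorem map_proj_degMeasure (σ : ConsistentSpace) (r : ℕ) :
    SubProb.map (proj r) (degMeasure σ) = marginal σ r :=
  (exists_measure σ).choose_spec r

theorem ext_proj {σ τ : ConsistentSpace} (h : ∀ r, proj r σ = proj r τ) : σ = τ :=
  Subtype.ext (funext h)

theorem measure_ext {μ ν : Measure ConsistentSpace} [IsFiniteMeasure μ]
    (h : ∀ r, μ.map (proj r) = ν.map (proj r)) : μ = ν := by
  have h1 : ∀ (r : ℕ) (A : Set (IterSpace r)), MeasurableSet A →
      μ (proj r ⁻¹' A) = ν (proj r ⁻¹' A) := by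
    intro r A hA
    rw [← Measure.map_apply (proj r).continuous.measurable hA, h,
      Measure.map_apply (proj r).continuous.measurable hA]
  refine ext_of_generate_finite _ measurableSpace_eq isPiSystem_cylinder ?_
    (h1 0 _ MeasurableSet.univ)
  rintro _ ⟨r, A, hA, rfl⟩
  exact h1 r A hA

theorem ofMeasure_degMeasure (σ : ConsistentSpace) : ofMeasure (degMeasure σ) = σ := by
  refine ext_proj fun r => ?_
  cases r with
  | zero => exact Subsingleton.elim _ _
  | succ r => exact map_proj_degMeasure σ r

theorem degMeasure_ofMeasure (μ : SubProb ConsistentSpace) : degMeasure (ofMeasure μ) = μ := by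
  refine SubProb.ext (measure_ext fun r => ?_)
  rw [← SubProb.toMeasure_map, ← SubProb.toMeasure_map, map_proj_degMeasure, marginal_ofMeasure]

/-- Measures on `M` correspond to points of `M`. -/
noncomputable def measureHomeo : SubProb ConsistentSpace ≃ₜ ConsistentSpace :=
  Continuous.homeoOfEquivCompactToT2
    (f := ⟨ofMeasure, degMeasure, degMeasure_ofMeasure, ofMeasure_degMeasure⟩)
    ofMeasure.continuous

/-- A continuous bijection from a compact space to a Hausdorff space has a continuous inverse. This
is the Feller property of `deg`, on which every passage to the limit rests. -/
theorem continuous_degMeasure : Continuous degMeasure :=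
  measureHomeo.symm.continuous

/-- The operator `g ↦ ∫ g d deg(x)` on continuous functions. -/
noncomputable def degInt (g : C(ConsistentSpace, ℝ≥0)) : C(ConsistentSpace, ℝ≥0) :=
  (SubProb.integ g).comp ⟨degMeasure, continuous_degMeasure⟩

theorem coe_degInt (g : C(ConsistentSpace, ℝ≥0)) (x : ConsistentSpace) :
    (degInt g x : ℝ≥0∞) = ∫⁻ y, g y ∂deg x :=
  SubProb.coe_integ g (degMeasure x)

theorem degInt_comp_proj (r : ℕ) (g : C(IterSpace r, ℝ≥0)) (x : ConsistentSpace) :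
    degInt (g.comp (proj r)) x = SubProb.integ g (marginal x r) := by
  rw [← map_proj_degMeasure, SubProb.integ_map]
  rfl

end ConsistentSpace

/-! ### Rooted trees and their densities -/

/-- Rooted trees: a single node, or two rooted trees with an edge between their roots, rooted at
the root of the first one. -/
inductive RootedTree : Type
  | point : RootedTree
  | graft (t s : RootedTree) : RootedTree

namespace RootedTree

open ConsistentSpace

/-- Identify the roots. -/
def glue (t : RootedTree) : RootedTree → RootedTree
  | point => t
  | graft s₁ s₂ => graft (glue t s₁) s₂

/-- The subtree of nodes at distance at most `r` from the root. -/
def trunc : RootedTree → ℕ → RootedTree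
  | point, _ => point
  | graft _ _, 0 => point
  | graft t s, r + 1 => graft (trunc t (r + 1)) (trunc s r)

/-- The rooted density as a function on `M`. -/
noncomputable def dens : RootedTree → C(ConsistentSpace, ℝ≥0)
  | point => 1
  | graft t s => dens t * degInt (dens s)

/-- The integral of a continuous function on `M_r`, as a function on `M_{r+1}`. -/
noncomputable def integAt (r : ℕ) (g : C(IterSpace r, ℝ≥0)) : C(IterSpace (r + 1), ℝ≥0) :=
  SubProb.integ g

/-- The rooted density of the truncation at height `r`, as a function on `M_r`. -/
noncomputable def densAt : RootedTree → (r : ℕ) → C(IterSpace r, ℝ≥0)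
  | point, _ => 1
  | graft _ _, 0 => 1
  | graft t s, r + 1 => densAt t (r + 1) * integAt r (densAt s r)

/-- Branches at the root are integrated independently of each other. This supplies the closure under
products that Stone–Weierstrass needs. -/
theorem dens_glue (t s : RootedTree) : dens (glue t s) = dens t * dens s := by
  induction s with
  | point => simp [glue, dens]
  | graft s₁ s₂ ih _ => rw [glue, dens, ih, dens, mul_assoc]

theorem densAt_zero (t : RootedTree) : densAt t 0 = 1 := by
  cases t <;> rfl

theorem densAt_glue (t s : RootedTree) (r : ℕ) :
    densAt (glue t s) r = densAt t r * densAt s r := by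
  cases r with
  | zero => simp [densAt_zero]
  | succ r =>
    induction s with
    | point => simp [glue, densAt]
    | graft s₁ s₂ ih _ => rw [glue, densAt, ih, densAt, mul_assoc]

/-- Integrating a function of the coordinate `σ_r` against `deg σ` only involves the marginal
`σ_{r+1}`, so each further level of a tree costs one coordinate. -/
theorem dens_trunc (t : RootedTree) (r : ℕ) : dens (trunc t r) = (densAt t r).comp (proj r) := by
  induction t generalizing r with
  | point => rfl
  | graft t s iht ihs =>
    cases r with
    | zero => rfl
    | succ r =>
      rw [trunc, dens, iht, ihs]
      ext x
      simp only [densAt, ContinuousMap.mul_apply, ContinuousMap.comp_apply, degInt_comp_proj]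
      rfl

/-- Two points of M_{r+1} are measures on M_r. By induction the densities separate M_r, so their
integrals determine the measure, and the integral of the density of `s` is the density of `s` hung
below a new root. -/
theorem densAt_separates (r : ℕ) : ∀ x y : IterSpace r,
    (∀ t, densAt t r x = densAt t r y) → x = y := by
  induction r with
  | zero => exact fun x y _ => Subsingleton.elim _ _
  | succ r ih =>
    intro (μ : SubProb (IterSpace r)) (ν : SubProb (IterSpace r)) h
    refine SubProb.ext (measure_eq_of_moments (fun t => densAt t r) ⟨point, rfl⟩
      (fun t s => ⟨glue t s, densAt_glue t s r⟩) ih fun s => ?_)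
    have h1 := h (graft point s)
    simp only [densAt, one_mul] at h1
    rw [← SubProb.coe_integ, ← SubProb.coe_integ]
    exact congrArg _ h1

theorem dens_separates (x y : ConsistentSpace) (h : ∀ t, dens t x = dens t y) : x = y := by
  refine ext_proj fun r => densAt_separates r _ _ fun t => ?_
  have h1 := h (trunc t r)
  rwa [dens_trunc] at h1

theorem measure_eq_of_dens {μ ν : Measure ConsistentSpace} [IsFiniteMeasure μ] [IsFiniteMeasure ν]
    (h : ∀ t, ∫⁻ x, dens t x ∂μ = ∫⁻ x, dens t x ∂ν) : μ = ν :=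
  measure_eq_of_moments dens ⟨point, rfl⟩ (fun t s => ⟨glue t s, dens_glue t s⟩) dens_separates h

end RootedTree
-- Manipulating labelled trees and iterated integrals
section Labelings

variable {W W' : Type} {F : SimpleGraph W} {X : Type*} [MeasurableSpace X] (κ : Kernel X X)

theorem nodes_map (e : W → W') (o : W) (R : List (W × W)) :
    nodes (e o) (R.map (Prod.map e e)) = (nodes o R).map e := by
  simp [nodes, Function.comp_def]

theorem Admissible.adj {o : W} {R : List (W × W)} (h : Admissible F o R) :
    ∀ p ∈ R, F.Adj p.1 p.2 := by
  induction h with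
  | nil => simp
  | cons i j R _ _ _ hij ih => simpa [hij] using fun a b => ih (a, b)

theorem Admissible.mem_nodes {o : W} {R : List (W × W)} (h : Admissible F o R) :
    ∀ p ∈ R, p.1 ∈ nodes o R ∧ p.2 ∈ nodes o R := by
  induction h with
  | nil => simp
  | cons i j R _ _ hj _ ih =>
    intro p hp
    rw [mem_nodes_cons, mem_nodes_cons]
    rcases List.mem_cons.1 hp with rfl | hp
    · exact ⟨Or.inl rfl, Or.inr hj⟩
    · exact (ih p hp).imp Or.inr Or.inr

/-- Over `⊤` adjacency only means distinctness, so lists can be built there first and the graph read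
off from them afterwards. -/
theorem Admissible.of_top {o : W} {R : List (W × W)} (h : Admissible (⊤ : SimpleGraph W) o R)
    (hF : ∀ p ∈ R, F.Adj p.1 p.2) : Admissible F o R := by
  induction h with
  | nil => exact .nil
  | cons i j R _ hi hj _ ih =>
    exact .cons _ _ _ (ih fun p hp => hF p (List.mem_cons_of_mem _ hp)) hi hj
      (hF _ List.mem_cons_self)

theorem Admissible.map_top {o : W} {R : List (W × W)} (h : Admissible (⊤ : SimpleGraph W) o R)
    {e : W → W'} (he : Function.Injective e) :
    Admissible (⊤ : SimpleGraph W') (e o) (R.map (Prod.map e e)) := by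
  induction h with
  | nil => exact .nil
  | cons i j R _ hi hj hij ih =>
    refine .cons _ _ _ ih ?_ ?_ ?_
    · rwa [nodes_map, List.mem_map_of_injective he]
    · rwa [nodes_map, List.mem_map_of_injective he]
    · exact fun h => hij (he h)

/-- A finite graph all of whose edges occur in an admissible list is a tree. -/
theorem Admissible.isTree [Finite W] {o : W} {R : List (W × W)} (h : Admissible F o R)
    (htot : ∀ w, w ∈ nodes o R) (hF : ∀ a b, F.Adj a b → (a, b) ∈ R ∨ (b, a) ∈ R) :
    F.IsTree := by
  classical
  have := Fintype.ofFinite W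
  have hconn : F.Connected := by
    have : Nonempty W := ⟨o⟩
    refine ⟨fun a b => ?_⟩
    obtain ⟨p, -⟩ := h.exists_walk a (htot a)
    obtain ⟨q, -⟩ := h.exists_walk b (htot b)
    exact ⟨p.append q.reverse⟩
  refine SimpleGraph.isTree_iff_connected_and_card.2 ⟨hconn, ?_⟩
  -- There are at most `R.length` edges and at least `R.length + 1` vertices, while connectedness
  -- gives the opposite inequality; so the edge count is that of a tree.
  have h1 : F.edgeSet ⊆ ((R.map fun p => s(p.1, p.2)).toFinset : Set (Sym2 W)) := by
    intro e he
    induction e with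
    | h a b =>
      simp only [List.coe_toFinset, List.mem_map, Set.mem_ofPred_eq]
      rcases hF a b he with h | h
      · exact ⟨_, h, rfl⟩
      · exact ⟨_, h, Sym2.eq_swap⟩
  have h2 : Nat.card F.edgeSet ≤ R.length := by
    calc Nat.card F.edgeSet ≤ (R.map fun p => s(p.1, p.2)).toFinset.card := by
          rw [Nat.card_coe_set_eq, ← Set.ncard_coe_finset]
          exact Set.ncard_le_ncard h1 (Finset.finite_toSet _)
      _ ≤ R.length := (List.toFinset_card_le _).trans (by simp)
  have h3 := hconn.card_vert_le_card_edgeSet_add_one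
  have h4 := h.nodup.length_le_card
  rw [length_nodes, ← Nat.card_eq_fintype_card] at h4
  omega

theorem AdmissibleLabeling.length_rest [Finite W] (L : AdmissibleLabeling F) :
    L.rest.length = Nat.card W - 1 := by
  have := Fintype.ofFinite W
  have h1 := L.admissible.nodup.length_le_card
  have h2 : Fintype.card W ≤ (nodes L.root L.rest).length := by
    classical
    rw [← Finset.card_univ, ← List.toFinset_card_of_nodup L.admissible.nodup]
    exact Finset.card_le_card fun w _ => List.mem_toFinset.2 (L.total w)
  rw [length_nodes] at h1 h2
  rw [Nat.card_eq_fintype_card]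
  omega

/-- The head of the list carries the largest label and is integrated innermost, hence `A` comes
first. -/
theorem iterIntegral_append (A B : List (W × W)) (h : (W → X) → ℝ≥0∞) :
    iterIntegral κ (A ++ B) h = iterIntegral κ B (iterIntegral κ A h) := by
  induction A generalizing h with
  | nil => rfl
  | cons p A ih =>
    obtain ⟨i, j⟩ := p
    rw [List.cons_append, iterIntegral, ih]
    rfl

theorem iterIntegral_map {e : W → W'} (he : Function.Injective e) (R : List (W × W))
    (h : (W → X) → ℝ≥0∞) (x : W' → X) :
    iterIntegral κ (R.map (Prod.map e e)) (fun x => h (x ∘ e)) x =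
      iterIntegral κ R h (x ∘ e) := by
  classical
  induction R generalizing h with
  | nil => rfl
  | cons p R ih =>
    obtain ⟨i, j⟩ := p
    simp only [List.map_cons, Prod.map_apply, iterIntegral, Function.update_comp_eq_of_injective _ he]
    exact ih fun x => ∫⁻ y, h (Function.update x i y) ∂κ (x j)

/-- The value at `o` is never integrated out, so a factor depending on it alone is a constant
throughout. Its finiteness allows it to be pulled out with no measurability of `h`. -/
theorem iterIntegral_mul_left {o : W} {R : List (W × W)} (ho : ∀ p ∈ R, p.1 ≠ o)
    {c : X → ℝ≥0∞} (hc : ∀ x, c x ≠ ∞) (h : (W → X) → ℝ≥0∞) (x : W → X) :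
    iterIntegral κ R (fun x => c (x o) * h x) x = c (x o) * iterIntegral κ R h x := by
  classical
  induction R generalizing h with
  | nil => rfl
  | cons p R ih =>
    obtain ⟨i, j⟩ := p
    have hi : o ≠ i := (ho _ List.mem_cons_self).symm
    simp only [iterIntegral, Function.update_of_ne hi, lintegral_const_mul' _ _ (hc _)]
    exact ih (fun p hp => ho p (List.mem_cons_of_mem _ hp)) _

end Labelings

/-! ### Realizing rooted densities by labelled finite trees -/

namespace RootedTree

open ConsistentSpace

/-- For a graft, take the disjoint union of the node sets and give the nodes of `s` the larger
labels. Integrating them out leaves `dens s` at `o₂`; integrating `o₂` out leaves `degInt (dens s)`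
at the root `o₁`, which factors out of the integral for `t`. -/
theorem exists_list (t : RootedTree) : ∃ (W : Type) (_ : Finite W) (o : W) (R : List (W × W)),
    Admissible (⊤ : SimpleGraph W) o R ∧ (∀ w, w ∈ nodes o R) ∧
      ∀ x, iterIntegral deg R (fun _ => 1) x = dens t (x o) := by
  induction t with
  | point =>
    exact ⟨Unit, inferInstance, (), [], .nil, fun w => mem_nodes_nil.2 rfl, fun x => rfl⟩
  | graft t s iht ihs =>
    obtain ⟨W₁, _, o₁, R₁, hA₁, hT₁, hI₁⟩ := iht
    obtain ⟨W₂, _, o₂, R₂, hA₂, hT₂, hI₂⟩ := ihs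
    let B : List ((W₁ ⊕ W₂) × (W₁ ⊕ W₂)) := R₁.map (Prod.map Sum.inl Sum.inl)
    have hB : Admissible ⊤ (Sum.inl o₁) B := hA₁.map_top Sum.inl_injective
    have hBn : ∀ w, w ∈ nodes (Sum.inl o₁) B ↔ ∃ u, w = Sum.inl u := by
      intro w
      rw [nodes_map, List.mem_map]
      exact ⟨fun ⟨u, _, h⟩ => ⟨u, h.symm⟩, fun ⟨u, h⟩ => ⟨u, hT₁ u, h.symm⟩⟩
    -- The list for the second tree is kept as a parameter, so that admissibility can be proved by
    -- induction on it.
    let C (R : List (W₂ × W₂)) := R.map (Prod.map Sum.inr Sum.inr) ++ (Sum.inr o₂, Sum.inl o₁) :: B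
    have hCn : ∀ (R : List (W₂ × W₂)) w, w ∈ nodes (Sum.inl o₁) (C R) ↔
        (∃ u, w = Sum.inl u) ∨ ∃ u ∈ nodes o₂ R, w = Sum.inr u := by
      intro R w
      rw [← hBn]
      simp only [C, nodes, List.map_append, List.map_map, List.map_cons, List.mem_append,
        List.mem_cons, List.mem_map, Function.comp_apply, Prod.map_fst, List.not_mem_nil, or_false]
      constructor
      · rintro ((⟨p, hp, rfl⟩ | h | h) | h)
        · exact Or.inr ⟨p.1, Or.inl ⟨p, hp, rfl⟩, rfl⟩
        · exact Or.inr ⟨o₂, Or.inr rfl, h⟩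
        · exact Or.inl (Or.inl h)
        · exact Or.inl (Or.inr h)
      · rintro ((h | h) | ⟨u, ⟨p, hp, rfl⟩ | rfl, rfl⟩)
        · exact Or.inl (Or.inr (Or.inr h))
        · exact Or.inr h
        · exact Or.inl (Or.inl ⟨p, hp, rfl⟩)
        · exact Or.inl (Or.inr (Or.inl rfl))
    have hC : ∀ R, Admissible (⊤ : SimpleGraph W₂) o₂ R →
        Admissible (⊤ : SimpleGraph (W₁ ⊕ W₂)) (Sum.inl o₁) (C R) := by
      intro R hR
      induction hR with
      | nil =>
        exact .cons _ _ _ hB (by simp [hBn]) ((hBn _).2 ⟨_, rfl⟩) (by simp)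
      | cons i j R _ hi hj hij ih =>
        refine .cons (Sum.inr i) (Sum.inr j) (C R) ih ?_ ?_ ?_
        · simpa [hCn] using hi
        · simpa [hCn] using hj
        · simpa using hij
    refine ⟨W₁ ⊕ W₂, inferInstance, Sum.inl o₁, C R₂, hC R₂ hA₂, fun w => ?_, fun x => ?_⟩
    · rw [hCn]
      rcases w with u | u
      · exact Or.inl ⟨u, rfl⟩
      · exact Or.inr ⟨u, hT₂ u, rfl⟩
    · have h1 : iterIntegral deg (R₂.map (Prod.map Sum.inr Sum.inr)) (fun _ => 1) =
          fun z : W₁ ⊕ W₂ → ConsistentSpace => (dens s (z (Sum.inr o₂)) : ℝ≥0∞) := by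
        funext z
        exact (iterIntegral_map deg Sum.inr_injective R₂ (fun _ => 1) z).trans (hI₂ _)
      have h2 : ∀ p ∈ B, p.1 ≠ Sum.inl o₁ := by
        intro p hp h
        have h3 := hB.nodup
        rw [nodes, List.nodup_append'] at h3
        exact h3.2.2 (List.mem_map_of_mem hp) (by simp [h])
      rw [iterIntegral_append, h1, iterIntegral]
      simp only [Function.update_self, ← coe_degInt]
      have h3 := iterIntegral_mul_left deg h2 (c := fun y => (degInt (dens s) y : ℝ≥0∞))
        (fun _ => ENNReal.coe_ne_top) (fun _ => 1) x
      simp only [mul_one] at h3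
      rw [h3]
      have h4 := (iterIntegral_map deg Sum.inl_injective R₁ (fun _ => 1) x).trans (hI₁ _)
      rw [h4, dens, mul_comm]
      rfl

/-- The rooted densities on `M` are rooted densities of finite trees. -/
theorem exists_tree (t : RootedTree) : ∃ (W : Type) (_ : Finite W) (F : SimpleGraph W)
    (_ : F.IsTree) (L : AdmissibleLabeling F),
    ∀ x, rootedDensity deg L x = dens t x := by
  obtain ⟨W, hW, o, R, hA, hT, hI⟩ := t.exists_list
  -- Only the listed pairs become edges, which forces `F` to be a tree.
  let F : SimpleGraph W := SimpleGraph.fromRel fun a b => (a, b) ∈ R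
  have hF : Admissible F o R := hA.of_top fun p hp => ⟨hA.adj p hp, Or.inl hp⟩
  exact ⟨W, hW, F, hF.isTree hT fun a b h => h.2, ⟨o, R, hF, hT⟩, fun x => hI _⟩

end RootedTree

/-- Reversible measures on `M` are determined by their tree densities. -/
theorem eq_of_treeDensity_eq {μ ν : Measure ConsistentSpace} [IsFiniteMeasure μ]
    [IsFiniteMeasure ν] (hμ : ConsistentSpace.deg.IsReversible μ)
    (hν : ConsistentSpace.deg.IsReversible ν)
    (h : ∀ (W : Type) [Finite W] (F : SimpleGraph W) (hF : F.IsTree),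
      treeDensity ConsistentSpace.deg μ hF = treeDensity ConsistentSpace.deg ν hF) : μ = ν := by
  refine RootedTree.measure_eq_of_dens fun t => ?_
  obtain ⟨W, _, F, hF, L, hL⟩ := t.exists_tree
  have h1 := h W F hF
  -- `treeDensity` uses an arbitrary labelling; reversibility permits the one rooted at the root of
  -- `t`.
  rw [treeDensity_eq hμ hF L, treeDensity_eq hν hF L] at h1
  simpa only [labeledDensity, hL] using h1

open ConsistentSpace

/-! ### Continuity of densities and closedness of reversibility -/

section Limits

variable {W : Type} {F : SimpleGraph W}

/-- The rooted densities on `M` are continuous. -/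
theorem exists_weighted_eq {o : W} {R : List (W × W)} (h : Admissible F o R)
    (g : W → C(ConsistentSpace, ℝ≥0)) : ∃ f : C(ConsistentSpace, ℝ≥0),
      ∀ π : Measure ConsistentSpace,
        weighted deg π o R (fun w x => (g w x : ℝ≥0∞)) = ∫⁻ x, f x ∂π := by
  classical
  induction h generalizing g with
  | nil => exact ⟨g o, fun π => by simp [weighted, iterIntegral, nodes]⟩
  | cons i j R hR hi hj hij ih =>
    -- Integrating out `i` multiplies the weight at its neighbour `j` by `degInt (g i)`, which is
    -- again continuous; this is why arbitrary continuous weights are carried through the induction.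
    obtain ⟨f, hf⟩ := ih (Function.update g j (g j * degInt (g i)))
    refine ⟨f, fun π => ?_⟩
    rw [weighted_cons deg π (.cons i j R hR hi hj hij) (fun w => by fun_prop), ← hf]
    congr 1
    funext w x
    by_cases hw : w = j
    · subst hw
      simp [absorb, coe_degInt]
    · simp [absorb, hw]

theorem exists_treeDensity_eq [Finite W] (hF : F.IsTree) : ∃ f : C(ConsistentSpace, ℝ≥0),
    ∀ π : Measure ConsistentSpace, treeDensity deg π hF = ∫⁻ x, f x ∂π := by
  let L := (nonempty_admissibleLabeling hF).some
  obtain ⟨f, hf⟩ := exists_weighted_eq L.admissible fun _ => 1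
  refine ⟨f, fun π => ?_⟩
  rw [← hf]
  simp [treeDensity, labeledDensity, rootedDensity, weighted, L]

theorem tendsto_lintegral {ι : Type*} {l : Filter ι} {ν : ι → ProbabilityMeasure ConsistentSpace}
    {ν₀ : ProbabilityMeasure ConsistentSpace} (h : Tendsto ν l (𝓝 ν₀))
    (f : C(ConsistentSpace, ℝ≥0)) :
    Tendsto (fun i => ∫⁻ x, f x ∂(ν i : Measure ConsistentSpace)) l
      (𝓝 (∫⁻ x, f x ∂(ν₀ : Measure ConsistentSpace))) :=
  ProbabilityMeasure.tendsto_iff_forall_lintegral_tendsto.1 h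
    (BoundedContinuousFunction.mkOfCompact f)

instance : IsFiniteKernel deg := ⟨1, ENNReal.one_lt_top, deg_univ_le⟩

/-- Reversibility can be tested on continuous functions. -/
theorem isReversible_of_continuous {π : Measure ConsistentSpace} [IsFiniteMeasure π]
    (h : ∀ f g : C(ConsistentSpace, ℝ≥0),
      ∫⁻ x, (f * degInt g) x ∂π = ∫⁻ x, (g * degInt f) x ∂π) : deg.IsReversible π := by
  have hfin : ∀ g : C(ConsistentSpace, ℝ≥0), ∫⁻ x, g x ∂π ≠ ∞ := fun g =>
    (BoundedContinuousFunction.mkOfCompact g).lintegral_lt_top_of_nnreal π |>.ne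
  -- The two test functions are replaced by sets one at a time. With `g` fixed, the hypothesis for
  -- all `f` is an equality of measures.
  have h1 : ∀ g : C(ConsistentSpace, ℝ≥0), π.withDensity (fun x => degInt g x) =
      (π.withDensity fun x => g x).bind deg := by
    intro g
    have := isFiniteMeasure_withDensity (hfin (degInt g))
    refine ext_of_forall_lintegral_eq_of_IsFiniteMeasure fun f => ?_
    have h2 := h f.toContinuousMap g
    have hf : Measurable fun x => (f x : ℝ≥0∞) := by fun_prop
    rw [Measure.lintegral_bind deg.aemeasurable hf.aemeasurable,
      lintegral_withDensity_eq_lintegral_mul _ (by fun_prop) hf,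
      lintegral_withDensity_eq_lintegral_mul _ (by fun_prop) hf.lintegral_kernel]
    simpa [mul_comm, coe_degInt] using h2
  -- Evaluating the previous equality at `B` and now letting `g` vary gives a second equality of
  -- measures, whose value at `A` is reversibility.
  have h3 : ∀ B, MeasurableSet B →
      (π.restrict B).bind deg = π.withDensity fun x => deg x B := by
    intro B hB
    have : IsFiniteMeasure ((π.restrict B).bind deg) := inferInstance
    refine ext_of_forall_lintegral_eq_of_IsFiniteMeasure fun g => ?_
    have h2 := congrArg (fun m => m B) (h1 g.toContinuousMap)
    beta_reduce at h2
    have hg : Measurable fun x => (g x : ℝ≥0∞) := by fun_prop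
    rw [Measure.lintegral_bind deg.aemeasurable hg.aemeasurable,
      lintegral_withDensity_eq_lintegral_mul _ (deg.measurable_coe hB) hg]
    rw [withDensity_apply _ hB, Measure.bind_apply hB deg.aemeasurable,
      lintegral_withDensity_eq_lintegral_mul _ (by fun_prop) (deg.measurable_coe hB)] at h2
    simpa [mul_comm, coe_degInt] using h2
  intro A B hA hB
  have h4 := congrArg (fun m => m A) (h3 B hB)
  beta_reduce at h4
  rw [Measure.bind_apply hA deg.aemeasurable, withDensity_apply _ hA] at h4
  exact h4.symm

theorem reversible_continuous {π : Measure ConsistentSpace} (h : deg.IsReversible π)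
    (f g : C(ConsistentSpace, ℝ≥0)) :
    ∫⁻ x, (f * degInt g) x ∂π = ∫⁻ x, (g * degInt f) x ∂π := by
  simpa [coe_degInt] using reversible_lintegral h (f := fun x => (f x : ℝ≥0∞))
    (g := fun x => (g x : ℝ≥0∞)) (by fun_prop) (by fun_prop)

/-- Since `degInt` preserves continuity, both sides of the reversibility identity are integrals of
continuous functions and pass to the weak limit. -/
theorem isReversible_of_tendsto {ι : Type*} {l : Filter ι} [l.NeBot]
    {ν : ι → ProbabilityMeasure ConsistentSpace} {ν₀ : ProbabilityMeasure ConsistentSpace}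
    (h : Tendsto ν l (𝓝 ν₀))
    (hν : ∀ i, deg.IsReversible (ν i : Measure ConsistentSpace)) :
    deg.IsReversible (ν₀ : Measure ConsistentSpace) := by
  refine isReversible_of_continuous fun f g => ?_
  refine tendsto_nhds_unique (tendsto_lintegral h _) ?_
  simp only [fun i => reversible_continuous (hν i) f g]
  exact tendsto_lintegral h _

end Limits

/-! ### Mapping a finite graph to M -/

section Graphs

variable {V : Type*} [Fintype V] {G : SimpleGraph V} {d : ℝ}

open Classical in
/-- The measure `d⁻¹ ∑ δ_{φ(u)}`, where `u` runs over the neighbours of `v`. -/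
noncomputable def nbrMeasure (G : SimpleGraph V) (d : ℝ) {K : Type*} [MeasurableSpace K]
    (φ : V → K) (v : V) : Measure K :=
  ENNReal.ofReal d⁻¹ • ∑ u with G.Adj v u, Measure.dirac (φ u)

/-- The total mass is the degree of `v` divided by `d`; the degree bound enters here. -/
theorem nbrMeasure_univ_le (h : IsAdmissiblePair G d) {K : Type*} [MeasurableSpace K]
    (φ : V → K) (v : V) : nbrMeasure G d φ v Set.univ ≤ 1 := by
  classical
  have hd : 0 < d := zero_lt_one.trans_le h.1
  have h1 := h.2 v
  rw [show G.neighborSet v = (Finset.univ.filter (G.Adj v) : Finset V) by ext; simp,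
    Set.ncard_coe_finset] at h1
  simp only [nbrMeasure, Measure.smul_apply, Measure.finsetSum_apply, measure_univ,
    Finset.sum_const, smul_eq_mul, nsmul_eq_mul, mul_one]
  rw [← ENNReal.ofReal_natCast, ← ENNReal.ofReal_mul (inv_nonneg.2 hd.le), ENNReal.ofReal_le_one,
    inv_mul_le_iff₀ hd, mul_one]
  exact h1

open Classical in
theorem lintegral_nbrMeasure {K : Type*} [MeasurableSpace K] [MeasurableSingletonClass K]
    (φ : V → K) (v : V) (f : K → ℝ≥0∞) : ∫⁻ y, f y ∂nbrMeasure G d φ v =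
      ENNReal.ofReal d⁻¹ * ∑ u with G.Adj v u, f (φ u) := by
  rw [nbrMeasure, lintegral_smul_measure, lintegral_finsetSum_measure, smul_eq_mul]
  simp only [lintegral_dirac]

/-- The measure `nbrMeasure` as a point of `SubProb K`. -/
noncomputable def nbr (h : IsAdmissiblePair G d) {K : Type} [TopologicalSpace K]
    [MeasurableSpace K] [BorelSpace K] (φ : V → K) (v : V) : SubProb K :=
  ⟨⟨nbrMeasure G d φ v, ⟨(nbrMeasure_univ_le h φ v).trans_lt ENNReal.one_lt_top⟩⟩,
    ENNReal.coe_le_coe.1 (FiniteMeasure.ennreal_mass.trans_le (nbrMeasure_univ_le h φ v))⟩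

theorem map_nbr (h : IsAdmissiblePair G d) {K L : Type} [TopologicalSpace K]
    [MeasurableSpace K] [BorelSpace K] [TopologicalSpace L] [MeasurableSpace L] [BorelSpace L]
    (f : C(K, L)) (φ : V → K) (v : V) : SubProb.map f (nbr h φ v) = nbr h (f ∘ φ) v := by
  classical
  refine SubProb.ext ?_
  change (nbrMeasure G d φ v).map f = nbrMeasure G d (f ∘ φ) v
  have hf := f.continuous.measurable
  rw [nbrMeasure, Measure.map_smul, ← Measure.mapₗ_apply_of_measurable hf, map_sum]
  simp only [Measure.mapₗ_apply_of_measurable hf, Measure.map_dirac' hf]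
  rfl

/-- The coordinates of the map from a graph to `M`. -/
noncomputable def embedAt (h : IsAdmissiblePair G d) : (r : ℕ) → V → IterSpace r
  | 0, _ => IterSpace.point
  | r + 1, v => nbr h (embedAt h r) v

theorem connect_embedAt (h : IsAdmissiblePair G d) (r : ℕ) :
    connect r ∘ embedAt h (r + 1) = embedAt h r := by
  induction r with
  | zero => exact funext fun v => Subsingleton.elim _ _
  | succ r ih =>
    funext v
    change SubProb.map (connect r) (nbr h (embedAt h (r + 1)) v) = nbr h (embedAt h r) v
    rw [map_nbr, ih]

/-- The map from a graph to `M`. -/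
noncomputable def embed (h : IsAdmissiblePair G d) (v : V) : ConsistentSpace :=
  ⟨fun r => embedAt h r v, fun r => congrFun (connect_embedAt h r) v⟩

/-- The coordinates of `embed h v` are the marginals of the neighbour measure transported to M by
`embed h` itself, and `degMeasure` inverts the passage to marginals. -/
theorem deg_embed (h : IsAdmissiblePair G d) (v : V) :
    deg (embed h v) = nbrMeasure G d (embed h) v := by
  have h1 : embed h v = ofMeasure (nbr h (embed h) v) := by
    refine ext_proj fun r => ?_
    cases r with
    | zero => exact Subsingleton.elim _ _
    | succ r => exact (map_nbr h (proj r) (embed h) v).symm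
  rw [h1]
  exact congrArg SubProb.toMeasure (degMeasure_ofMeasure _)

open Classical in
theorem lintegral_deg_embed (h : IsAdmissiblePair G d) (v : V) (f : ConsistentSpace → ℝ≥0∞) :
    ∫⁻ y, f y ∂deg (embed h v) =
      ENNReal.ofReal d⁻¹ * ∑ u with G.Adj v u, f (embed h u) := by
  rw [deg_embed, lintegral_nbrMeasure]

/-- The distribution on `M` of the image of a uniformly random node. -/
noncomputable def nodeMeasure (h : IsAdmissiblePair G d) : Measure ConsistentSpace :=
  (Nat.card V : ℝ≥0∞)⁻¹ • ∑ v, Measure.dirac (embed h v)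

theorem lintegral_nodeMeasure (h : IsAdmissiblePair G d) (f : ConsistentSpace → ℝ≥0∞) :
    ∫⁻ x, f x ∂nodeMeasure h = (Nat.card V : ℝ≥0∞)⁻¹ * ∑ v, f (embed h v) := by
  rw [nodeMeasure, lintegral_smul_measure, lintegral_finsetSum_measure, smul_eq_mul]
  simp only [lintegral_dirac]

instance [Nonempty V] (h : IsAdmissiblePair G d) : IsProbabilityMeasure (nodeMeasure h) := by
  refine ⟨?_⟩
  rw [← lintegral_one, lintegral_nodeMeasure]
  simp only [Finset.sum_const, Finset.card_univ, nsmul_eq_mul, mul_one, Nat.card_eq_fintype_card]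
  exact ENNReal.inv_mul_cancel (by simp) (by simp)

/-- Up to a common factor both sides are sums over ordered pairs of adjacent vertices, exchanged by
swapping the pair. -/
theorem isReversible_nodeMeasure [Nonempty V] (h : IsAdmissiblePair G d) :
    deg.IsReversible (nodeMeasure h) := by
  classical
  refine isReversible_of_continuous fun f g => ?_
  simp only [ContinuousMap.mul_apply, ENNReal.coe_mul, coe_degInt, lintegral_nodeMeasure,
    lintegral_deg_embed, mul_left_comm _ (ENNReal.ofReal d⁻¹), ← Finset.mul_sum]
  congr 2
  simp only [Finset.mul_sum, Finset.sum_filter]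
  rw [Finset.sum_comm]
  refine Finset.sum_congr rfl fun u _ => Finset.sum_congr rfl fun v _ => ?_
  rw [G.adj_comm]
  split_ifs
  · exact mul_comm _ _
  · rw [mul_zero, mul_zero]

end Graphs

/-! ### Tree densities of the node measure are homomorphism densities -/

section HomDensity

variable {W : Type} {F : SimpleGraph W} {V : Type*} [Fintype V] {G : SimpleGraph V} {d : ℝ}

/-- In an acyclic graph, the edges inside an admissible list occur in the list. -/
theorem Admissible.mem_of_adj (hF : F.IsAcyclic) {o : W} {R : List (W × W)}
    (h : Admissible F o R) : ∀ a ∈ nodes o R, ∀ b ∈ nodes o R, F.Adj a b →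
      (a, b) ∈ R ∨ (b, a) ∈ R := by
  induction h with
  | nil =>
    intro a ha b hb hab
    rw [mem_nodes_nil] at ha hb
    exact absurd (ha.trans hb.symm) hab.ne
  | cons i j R hR hi hj hij ih =>
    intro a ha b hb hab
    rcases mem_nodes_cons.1 ha with rfl | ha'
    · have hb := (mem_nodes_cons.1 hb).resolve_left hab.ne'
      exact Or.inl (hR.eq_of_adj hF hi hb hj hab hij ▸ List.mem_cons_self)
    · rcases mem_nodes_cons.1 hb with rfl | hb
      · exact Or.inr (hR.eq_of_adj hF hi ha' hj hab.symm hij ▸ List.mem_cons_self)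
      · exact (ih a ha' b hb hab).imp (List.mem_cons_of_mem _) (List.mem_cons_of_mem _)

/-- Homomorphisms from a labelled tree. -/
def AdmissibleLabeling.homEquiv (hF : F.IsAcyclic) (L : AdmissibleLabeling F) :
    (F →g G) ≃ {y : W → V // ∀ p ∈ L.rest, G.Adj (y p.2) (y p.1)} where
  toFun f := ⟨f, fun p hp => f.map_adj (L.admissible.adj p hp).symm⟩
  invFun y := ⟨y.1, fun {a b} hab => by
    rcases L.admissible.mem_of_adj hF a (L.total a) b (L.total b) hab with h | h
    · exact (y.2 _ h).symm
    · exact y.2 _ h⟩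
  left_inv _ := rfl
  right_inv _ := rfl

open Classical in
/-- The indicator of the maps that send the pairs of the list to edges. -/
noncomputable def edgeIndicator (G : SimpleGraph V) (R : List (W × W)) (y : W → V) : ℝ≥0∞ :=
  if ∀ p ∈ R, G.Adj (y p.2) (y p.1) then 1 else 0

-- Each kernel integral is `d⁻¹` times a sum over neighbours, that is, over all vertices with an
-- adjacency indicator. The marginal for counting measure is then the sum over all placements of the
-- listed nodes, with the root held fixed.
open Classical in
theorem iterIntegral_embed [Finite W] (h : IsAdmissiblePair G d) {o : W} {R : List (W × W)}
    (hR : Admissible F o R) (f : (W → ConsistentSpace) → ℝ≥0∞) (x : W → V) :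
    letI : MeasurableSpace V := ⊤
    iterIntegral deg R f (embed h ∘ x) = ENNReal.ofReal d⁻¹ ^ R.length *
      lmarginal (fun _ : W => (Measure.count : Measure V)) (R.map Prod.fst).toFinset
        (fun y => edgeIndicator G R y * f (embed h ∘ y)) x := by
  let _ : MeasurableSpace V := ⊤
  have hm : ∀ g : (W → V) → ℝ≥0∞, Measurable g := fun g => measurable_of_finite g
  induction hR generalizing f with
  | nil => simp [iterIntegral, edgeIndicator]
  | cons i j R hR hi hj hij ih =>
    have hi' : i ∉ (R.map Prod.fst).toFinset := fun hmem =>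
      hi (List.mem_append_left _ (List.mem_toFinset.1 hmem))
    rw [iterIntegral, ih, List.map_cons, List.toFinset_cons, lmarginal_insert' _ (hm _) hi',
      List.length_cons, pow_succ, mul_assoc]
    congr 1
    simp only [lmarginal]
    rw [← lintegral_const_mul' _ _ ENNReal.ofReal_ne_top]
    congr 1
    funext y
    generalize Function.updateFinset x (R.map Prod.fst).toFinset y = z
    rw [Function.comp_apply, lintegral_deg_embed, lintegral_count, tsum_fintype,
      mul_left_comm, Finset.mul_sum, Finset.sum_filter]
    congr 1
    refine Finset.sum_congr rfl fun u _ => ?_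
    -- The node `i` does not occur in `R`, so moving it affects only the new edge.
    have h1 : edgeIndicator G ((i, j) :: R) (Function.update z i u) =
        (if G.Adj (z j) u then 1 else 0) * edgeIndicator G R z := by
      have hji : j ≠ i := fun hji => hi (hji ▸ hj)
      have h2 : (∀ p ∈ R, G.Adj (Function.update z i u p.2) (Function.update z i u p.1)) ↔
          ∀ p ∈ R, G.Adj (z p.2) (z p.1) := by
        refine forall₂_congr fun p hp => ?_
        have h3 := hR.mem_nodes p hp
        rw [Function.update_of_ne (ne_of_mem_of_not_mem h3.1 hi),
          Function.update_of_ne (ne_of_mem_of_not_mem h3.2 hi)]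
      simp only [edgeIndicator, List.forall_mem_cons, h2, Function.update_self,
        Function.update_of_ne hji]
      by_cases hz : G.Adj (z j) u <;> simp [hz]
    rw [h1, Function.comp_update]
    by_cases hz : G.Adj (z j) u <;> simp [hz]

/-- Summing over the image of the root as well gives a sum over all maps from `W` to `V`, which
counts those sending listed pairs to edges; by `homEquiv` these are the homomorphisms. There is one
factor `d⁻¹` for each non-root node. -/
theorem treeDensity_nodeMeasure [Finite W] [Nonempty V] (h : IsAdmissiblePair G d)
    (hF : F.IsTree) : (treeDensity deg (nodeMeasure h) hF).toReal = homDensity F G d := by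
  classical
  let _ : MeasurableSpace V := ⊤
  have := Fintype.ofFinite W
  let L := (nonempty_admissibleLabeling hF).some
  let S : Finset W := (L.rest.map Prod.fst).toFinset
  have hm : ∀ g : (W → V) → ℝ≥0∞, Measurable g := fun g => measurable_of_finite g
  have hd : 0 < d := zero_lt_one.trans_le h.1
  have hS : L.root ∉ S := by
    have h1 := L.admissible.nodup
    rw [nodes, List.nodup_append'] at h1
    exact fun hmem => h1.2.2 (List.mem_toFinset.1 hmem) List.mem_cons_self
  have hSu : insert L.root S = Finset.univ := by
    refine Finset.eq_univ_of_forall fun w => ?_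
    have := L.total w
    simpa [nodes, S, or_comm] using this
  have h0 : ∀ v, rootedDensity deg L (embed h v) = ENNReal.ofReal d⁻¹ ^ L.rest.length *
      lmarginal (fun _ : W => (Measure.count : Measure V)) S
        (edgeIndicator G L.rest) (fun _ => v) := by
    intro v
    have h1 := iterIntegral_embed h L.admissible (fun _ => 1) fun _ => v
    simp only [mul_one] at h1
    exact h1
  have h1 : ∑ v, lmarginal (fun _ : W => (Measure.count : Measure V)) S
      (edgeIndicator G L.rest) (fun _ => v) = Nat.card (F →g G) := by
    have x : W → V := fun _ => Classical.arbitrary V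
    -- The root is the only coordinate not summed over, so the base point may be changed elsewhere;
    -- this puts the sum over `v` in the form of one more marginal.
    have h2 : ∀ v, lmarginal (fun _ : W => (Measure.count : Measure V)) S
        (edgeIndicator G L.rest) (fun _ => v) =
        lmarginal (fun _ : W => (Measure.count : Measure V)) S
          (edgeIndicator G L.rest) (Function.update x L.root v) := by
      intro v
      refine lmarginal_congr _ _ fun w hw => ?_
      have hw' := Finset.mem_univ w
      rw [← hSu, Finset.mem_insert] at hw'
      rw [hw'.resolve_right hw, Function.update_self]
    simp only [h2]
    rw [← tsum_fintype (L := .unconditional V), ← lintegral_count]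
    refine (lmarginal_insert (μ := fun _ : W => (Measure.count : Measure V)) _ (hm _) hS x).symm.trans
      ?_
    rw [hSu, lmarginal_univ, lintegral_fintype]
    simp only [Measure.pi_singleton, Measure.count_singleton, Finset.prod_const_one, mul_one]
    rw [Nat.card_congr (L.homEquiv hF.2), Nat.card_eq_fintype_card, Fintype.card_subtype]
    simp [edgeIndicator]
  have h2 : treeDensity deg (nodeMeasure h) hF = (Nat.card V : ℝ≥0∞)⁻¹ *
      (ENNReal.ofReal d⁻¹ ^ L.rest.length * Nat.card (F →g G)) := by
    change labeledDensity deg (nodeMeasure h) L = _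
    simp only [labeledDensity, lintegral_nodeMeasure, h0]
    rw [← Finset.mul_sum, h1]
  rw [h2, L.length_rest, homDensity]
  simp only [ENNReal.toReal_mul, ENNReal.toReal_inv, ENNReal.toReal_natCast, ENNReal.toReal_pow,
    ENNReal.toReal_ofReal (inv_nonneg.2 hd.le)]
  rw [inv_pow, div_eq_mul_inv, mul_inv]
  ring

end HomDensity

end GraphLimit

/-! ### Existence and uniqueness of the limit measure -/

theorem mainTheorem7 (V : ℕ → Type*) [∀ n, Finite (V n)] [∀ n, Nonempty (V n)]
    (G : (n : ℕ) → SimpleGraph (V n)) (d : ℕ → ℝ)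
    (hadm : ∀ n, GraphLimit.IsAdmissiblePair (G n) (d n))
    (hconv : ∀ (W : Type) [Finite W] (F : SimpleGraph W), F.IsTree →
      ∃ a : ℝ, Tendsto (fun n => GraphLimit.homDensity F (G n) (d n)) atTop (𝓝 a)) :
    ∃! ν : ProbabilityMeasure GraphLimit.ConsistentSpace,
      GraphLimit.ConsistentSpace.deg.IsReversible (ν : Measure GraphLimit.ConsistentSpace) ∧
      ∀ (W : Type) [Finite W] (F : SimpleGraph W) (hF : F.IsTree),
        Tendsto (fun n => GraphLimit.homDensity F (G n) (d n)) atTop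
          (𝓝 (GraphLimit.treeDensity GraphLimit.ConsistentSpace.deg
            (ν : Measure GraphLimit.ConsistentSpace) hF).toReal) := by
  have := fun n => Fintype.ofFinite (V n)
  let ν : ℕ → ProbabilityMeasure GraphLimit.ConsistentSpace := fun n =>
    ⟨GraphLimit.nodeMeasure (hadm n), inferInstance⟩
  have hne : ∀ ρ : ProbabilityMeasure GraphLimit.ConsistentSpace, ∀ (W : Type) [Finite W]
      (F : SimpleGraph W) (hF : F.IsTree), GraphLimit.treeDensity GraphLimit.ConsistentSpace.deg
        (ρ : Measure GraphLimit.ConsistentSpace) hF ≠ ∞ := fun ρ W _ F hF =>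
    ((GraphLimit.treeDensity_le_one GraphLimit.ConsistentSpace.deg_univ_le _ hF).trans_lt
      ENNReal.one_lt_top).ne
  -- By compactness the node measures converge along an ultrafilter finer than `atTop`, so no
  -- subsequence has to be extracted.
  let u : Ultrafilter ℕ := Ultrafilter.of atTop
  have hu : (u : Filter ℕ) ≤ atTop := Ultrafilter.of_le _
  obtain ⟨ν₀, -, hν₀⟩ := isCompact_univ.ultrafilter_le_nhds (u.map ν) (by simp)
  have hν₀ : Tendsto ν u (𝓝 ν₀) := hν₀
  have hν₀rev := GraphLimit.isReversible_of_tendsto hν₀ fun n =>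
    GraphLimit.isReversible_nodeMeasure (hadm n)
  have hν₀lim : ∀ (W : Type) [Finite W] (F : SimpleGraph W) (hF : F.IsTree),
      Tendsto (fun n => GraphLimit.homDensity F (G n) (d n)) atTop
        (𝓝 (GraphLimit.treeDensity GraphLimit.ConsistentSpace.deg
          (ν₀ : Measure GraphLimit.ConsistentSpace) hF).toReal) := by
    intro W _ F hF
    obtain ⟨a, ha⟩ := hconv W F hF
    obtain ⟨f, hf⟩ := GraphLimit.exists_treeDensity_eq hF
    have h1 := GraphLimit.tendsto_lintegral hν₀ f
    simp only [← hf] at h1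
    have h2 := (ENNReal.tendsto_toReal (hne ν₀ W F hF)).comp h1
    have h3 : Tendsto (fun n => GraphLimit.homDensity F (G n) (d n)) u
        (𝓝 (GraphLimit.treeDensity GraphLimit.ConsistentSpace.deg
          (ν₀ : Measure GraphLimit.ConsistentSpace) hF).toReal) :=
      h2.congr fun n => GraphLimit.treeDensity_nodeMeasure (hadm n) hF
    -- The full sequence converges by assumption, so its limit must be the one found along the
    -- ultrafilter.
    rwa [← tendsto_nhds_unique (ha.mono_left hu) h3]
  refine ⟨ν₀, ⟨hν₀rev, hν₀lim⟩, ?_⟩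
  rintro ν' ⟨hrev, hlim⟩
  refine Subtype.ext (GraphLimit.eq_of_treeDensity_eq
    (μ := (ν' : Measure GraphLimit.ConsistentSpace))
    (ν := (ν₀ : Measure GraphLimit.ConsistentSpace)) hrev hν₀rev fun W _ F hF => ?_)
  -- Both densities are the limit of the same real sequence, and `toReal` loses nothing because they
  -- are finite.
  exact (ENNReal.toReal_eq_toReal_iff' (hne ν' W F hF) (hne ν₀ W F hF)).1
    (tendsto_nhds_unique (hlim W F hF) (hν₀lim W F hF))
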